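/- **Setting.** Let $\mathcal S$ be a triangulated category with suspension $\Sigma$. A *good metric* on $\mathcal S$ is a sequence of full subcategories $\{\mathcal M_i,\ i\in\mathbb N\}$ containing $0$, with $\Sigma^{-1}\mathcal M_{i+1}\cup\mathcal M_{i+1}\cup\Sigma\mathcal M_{i+1}\subset\mathcal M_i$, and such that $x\in\mathcal M_i$ whenever there is a distinguished triangle $m\to x\to m'\to\Sigma m$ with $m,m'\in\mathcal M_i$. A sequence $E_*=(E_0\to E_1\to\cdots)$ in $\mathcal S$ is *Cauchy* if for every $i$ there is $N$ such that for all $m'>m\ge N$ the cone of $E_m\to E_{m'}$ is in $\mathcal M_i$. A *Cauchy sequence of triangles* is a sequence of distinguished triangles $a_*\to b_*\to c_*\to\Sigma a_*$ with $a_*,b_*,c_*$ Cauchy. Let $\mathrm{Mod}\text{-}\mathcal S$ be the category of additive functors $\mathcal S^{op}\to\mathrm{Ab}$, with $(\Sigma F)(s)=F(\Sigma^{-1}s)$, and let $Y:\mathcal S\to\mathrm{Mod}\text{-}\mathcal S$ be the Yoneda functor. Put: * $\mathfrak L(\mathcal S)\subset\mathrm{Mod}\text{-}\mathcal S$: the full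 subcategory of the colimits $\mathrm{colim}\,Y(E_*)$, $E_*$ Cauchy; $\mathcal L_i\subset\mathfrak L(\mathcal S)$: those for which $E_*$ can be chosen with all $E_n\in\mathcal M_i$. * *Strong triangle* in $\mathfrak L(\mathcal S)$: a diagram $A\to B\to C\to\Sigma A$ which is (isomorphic to) the colimit of the image under $Y$ of a Cauchy sequence of triangles. * $\mathfrak S(\mathcal S)=\mathfrak L(\mathcal S)\cap\bigcup_iY(\mathcal M_i)^\perp$, a triangulated category whose suspension is that of $\mathrm{Mod}\text{-}\mathcal S$ and whose distinguished triangles are the strong triangles with all terms in $\mathfrak S(\mathcal S)$; it has the good metric $\mathcal N_i=\mathcal L_i\cap\mathfrak S(\mathcal S)$. * $\mathfrak S(\mathcal S)^{op}$ carries the suspension $\Sigma^{-1}$, the metric $\{\mathcal N_i^{op}\}$, and as distinguished triangles $X\to Y\to Z\to\Sigma^{-1}X$ those which, with the arrows reversed, are distinguished triangles $\Sigma^{-1}X\to Z\to Y\to X$ in $\mathfrak S(\mathcal S)$. The notions above (Cauchy sequence, $\mathfrak L$, strong triangle) are applied to it too. * $\widehat Y:(\mathrm{Mod}\text{-}\mathcal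 S)^{op}\to\mathrm{Mod}\text{-}\mathfrak S(\mathcal S)^{op}$, $\widehat Y(M)=\mathrm{Hom}(M,-)|_{\mathfrak S(\mathcal S)}$. The suspension of $\mathrm{Mod}\text{-}\mathfrak S(\mathcal S)^{op}$ is precomposition with $\Sigma$, so $\widehat Y(A)$ is canonically identified with the suspension of $\widehat Y(\Sigma A)$ via $\Sigma:\mathrm{Hom}(A,Z)\cong\mathrm{Hom}(\Sigma A,\Sigma Z)$. A map $f_*:a_*\to b_*$ of Cauchy sequences is of *type $n$* if in any completion to a Cauchy sequence of triangles $a_*\to b_*\to c_*\to\Sigma a_*$ one has $c_i\in\mathcal M_n$ for $i\gg0$. If $A=\mathrm{colim}\,Y(a_*)$ and $B=\mathrm{colim}\,Y(b_*)$, a morphism $F:A\to B$ is of type $n$ with respect to $(a_*,b_*)$ if $F=\mathrm{colim}\,Y(f_*)$ for some type-$n$ map $f_*$ from a subsequence of $a_*$ to a subsequence of $b_*$. The metric is *excellent* if 1. $\mathcal S=\bigcup_i{}^\perp\mathcal M_i$; 2. for every $m$ there is $n>m$ such that every $F\in\mathcal S$ admits a distinguished triangle $E\to F\to D\to\Sigma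 E$ with $E\in{}^\perp\mathcal M_n$ and $D\in\mathcal M_m$; 3. for every $m$ there is $n>m$ such that every $F\in\mathcal S$ admits, for some Cauchy sequence $d_*$ with colimit $D=\mathrm{colim}\,Y(d_*)\in\mathfrak S(\mathcal S)\cap\mathcal L_n^\perp$, a morphism $Y(F)\to D$ of type $m$ with respect to $(F,d_*)$, where $F$ also denotes the constant sequence. **Proposition.** Let $\{\mathcal M_i\}$ be an excellent metric on $\mathcal S$, and let $A\xrightarrow fB\xrightarrow gC\xrightarrow h\Sigma A$ be a strong triangle in $\mathfrak L(\mathcal S)$. Then $$\widehat Y(A)\xleftarrow{\widehat Y(f)}\widehat Y(B)\xleftarrow{\widehat Y(g)}\widehat Y(C)\xleftarrow{\widehat Y(h)}\widehat Y(\Sigma A)$$ is a strong triangle in $\mathfrak L(\mathfrak S(\mathcal S)^{op})$. Moreover, let $a_*\to b_*\to c_*\to\Sigma a_*$ be any Cauchy sequence of triangles in $\mathcal S$, with a given identification of its colimit in $\mathrm{Mod}\text{-}\mathcal S$ with $A\to B\to C\to\Sigma A$, and let $\ell\in\mathbb N$. Then there is an inverse sequence $\tilde a_*\to\tilde b_*\to\tilde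 c_*\to\Sigma\tilde a_*$ of distinguished triangles in $\mathfrak S(\mathcal S)$, Cauchy when viewed as a sequence of triangles in $\mathfrak S(\mathcal S)^{op}$, whose inverse limit in $\mathrm{Mod}\text{-}\mathcal S$ is $A\xrightarrow fB\xrightarrow gC\xrightarrow h\Sigma A$, such that: * if $B\in\mathfrak S(\mathcal S)$ then, after a finite initial segment, $\tilde b_*$ is the constant sequence $\cdots\xrightarrow{\mathrm{id}}B\xrightarrow{\mathrm{id}}B$ (with the identity as the projection from the limit $B$); * if $c_n\in\mathcal M_\ell$ for all $n\gg0$ then $\tilde c_n\in\mathcal N_\ell$ for all $n\gg0$. -/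

import Mathlib

open CategoryTheory CategoryTheory.Limits CategoryTheory.Pretriangulated Opposite

universe v u

namespace ExcellentMetric

/-! ### Modules over a preadditive category -/

/-- Presheaves of abelian groups on `C`. All objects used below are sequential colimits of
representables, hence additive functors, and limits and colimits of additive functors are computed
pointwise; so nothing changes if one restricts to the full subcategory `Mod-C` of additive
functors. -/
abbrev ModCat (C : Type u) [Category.{v} C] : Type (max u (v + 1)) :=
  Cᵒᵖ ⥤ AddCommGrpCat.{v}

/-- The Yoneda embedding `Y : C ⥤ Mod-C`, `Y(a) = Hom(-, a)`. -/
abbrev Y (C : Type u) [Category.{v} C] [Preadditive C] : C ⥤ ModCat C :=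
  preadditiveYoneda

/-! ### Suspensions and distinguished triangles

To form the completion of a triangulated category one needs the category, its suspension (with a
quasi-inverse) and its class of distinguished triangles. This data is recorded here so that the same
constructions apply to a triangulated category `S` and to the opposite of the category `𝔖(S)`
built from it below. -/

/-- An additive autoequivalence `Σ` (the suspension) of `C` together with a class of candidate
triangles `X ⟶ Y ⟶ Z ⟶ ΣX`, called distinguished. -/
structure TriangleData (C : Type u) [Category.{v} C] [Preadditive C] where
  /-- The suspension, as an autoequivalence. -/
  shift : C ≌ C
  additive : shift.functor.Additive
  /-- The class of distinguished triangles. -/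
  Dist : ∀ {X Y Z : C}, (X ⟶ Y) → (Y ⟶ Z) → (Z ⟶ shift.functor.obj X) → Prop

namespace TriangleData

variable {C : Type u} [Category.{v} C] [Preadditive C]

/-- The data underlying a (pre)triangulated category. -/
@[simps]
def ofPretriangulated (S : Type u) [Category.{v} S] [Preadditive S] [HasZeroObject S]
    [HasShift S ℤ] [∀ n : ℤ, (shiftFunctor S n).Additive] [Pretriangulated S] :
    TriangleData S where
  shift := shiftEquiv S (1 : ℤ)
  additive := inferInstanceAs ((shiftFunctor S (1 : ℤ)).Additive)
  Dist f g h := Triangle.mk f g h ∈ distTriang S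

/-- The data on the opposite category: the suspension is (the opposite of) `Σ⁻¹`, and
`X ⟶ Y ⟶ Z ⟶ Σ⁻¹X` is distinguished in `Cᵒᵖ` when, read in `C`, the arrows form a distinguished
triangle `Σ⁻¹X ⟶ Z ⟶ Y ⟶ X ≅ Σ(Σ⁻¹X)`. -/
@[simps]
def op (D : TriangleData C) : TriangleData Cᵒᵖ where
  shift := D.shift.symm.op
  additive := by
    have := D.additive
    have : D.shift.inverse.Additive := D.shift.inverse_additive
    exact inferInstanceAs (D.shift.inverse.op.Additive)
  Dist {X _ _} u v w := D.Dist w.unop v.unop (u.unop ≫ D.shift.counitIso.inv.app X.unop)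

/-- The suspension of `Mod-C`: `(ΣF)(X) = F(Σ⁻¹X)`. -/
abbrev modShift (D : TriangleData C) : ModCat C ≌ ModCat C :=
  D.shift.op.congrLeft

/-- For a fixed object `X`, the isomorphism `Hom(X, Σa) ≅ Hom(Σ⁻¹X, a)`, sending `f` to
`Σ⁻¹f` followed by the canonical isomorphism `Σ⁻¹Σa ≅ a`. -/
def homShift (D : TriangleData C) (X a : C) :
    (X ⟶ D.shift.functor.obj a) ≃+ (D.shift.inverse.obj X ⟶ a) where
  toFun f := D.shift.inverse.map f ≫ D.shift.unitIso.inv.app a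
  invFun g := D.shift.counitIso.inv.app X ≫ D.shift.functor.map g
  left_inv f := by simp
  right_inv g := by simp
  map_add' f g := by
    have := D.additive
    have : D.shift.inverse.Additive := D.shift.inverse_additive
    simp [Functor.map_add]

/-- The canonical isomorphism `Y(Σa) ≅ ΣY(a)`, i.e. `Hom(-, Σa) ≅ Hom(Σ⁻¹(-), a)`. -/
def yonedaShift (D : TriangleData C) :
    D.shift.functor ⋙ Y C ≅ Y C ⋙ D.modShift.functor :=
  NatIso.ofComponents
    (fun a => NatIso.ofComponents
      (fun X => (AddEquiv.toAddCommGrpIso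
        (X := AddCommGrpCat.of (X.unop ⟶ D.shift.functor.obj a))
        (Y := AddCommGrpCat.of (D.shift.inverse.obj X.unop ⟶ a)) (D.homShift X.unop a) :))
      (by
        intro X Z f
        ext (x : X.unop ⟶ D.shift.functor.obj a)
        change D.shift.inverse.map (f.unop ≫ x) ≫ _ = D.shift.inverse.map f.unop ≫ _ ≫ _
        simp))
    (by
      intro a b f
      ext X (x : X.unop ⟶ D.shift.functor.obj a)
      change D.shift.inverse.map (x ≫ D.shift.functor.map f) ≫ _ = (_ ≫ _) ≫ f
      simp)

end TriangleData

/-! ### Sequential colimits of representables, and the completion -/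

section Completion

variable {C : Type u} [Category.{v} C] [Preadditive C]

/-- The data exhibiting `F` as `colim Y(E_*)`, for a sequence `E_0 ⟶ E_1 ⟶ ⋯` in `C`. -/
structure ColimPres (E : ℕ ⥤ C) (F : ModCat C) where
  /-- The colimit cocone. -/
  ι : E ⋙ Y C ⟶ (Functor.const ℕ).obj F
  isColimit : IsColimit (Cocone.mk F ι)

/-- The structure morphism `Y(E_n) ⟶ F`. -/
def ColimPres.leg {E : ℕ ⥤ C} {F : ModCat C} (p : ColimPres E F) (n : ℕ) :
    (Y C).obj (E.obj n) ⟶ F :=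
  p.ι.app n

/-- `Y(x)` is the colimit of the constant sequence `x = x = x = ⋯`. -/
def ColimPres.const (x : C) : ColimPres ((Functor.const ℕ).obj x) ((Y C).obj x) where
  ι := { app := fun _ => 𝟙 _ }
  isColimit :=
    { desc := fun s => s.ι.app 0
      fac := fun s n => by
        have := s.ι.naturality (homOfLE (Nat.zero_le n))
        simp at this ⊢
        exact this.symm
      uniq := fun s m hm => by
        have := hm 0
        simpa using this }

namespace TriangleData

variable (D : TriangleData C) (M : ℕ → ObjectProperty C)

/-- A sequence `E_0 ⟶ E_1 ⟶ ⋯` is Cauchy for the metric `{M_i}` if for each `i`, for all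
sufficiently large `m < m'`, the cone of `E_m ⟶ E_m'` (the third term of a distinguished triangle
on this morphism, unique up to isomorphism) lies in `M_i`. -/
def IsCauchy (E : ℕ ⥤ C) : Prop :=
  ∀ i : ℕ, ∃ N : ℕ, ∀ (m m' : ℕ) (_ : N ≤ m) (h : m < m'),
    ∃ (Z : C) (g : E.obj m' ⟶ Z) (k : Z ⟶ D.shift.functor.obj (E.obj m)),
      D.Dist (E.map (homOfLE h.le)) g k ∧ M i Z

/-- The completion `𝔏(C)`: colimits in `Mod-C` of images under `Y` of Cauchy sequences. -/
def completion : ObjectProperty (ModCat C) :=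
  fun F => ∃ E : ℕ ⥤ C, D.IsCauchy M E ∧ Nonempty (ColimPres E F)

/-- `𝔏_i ⊆ 𝔏(C)`: colimits of Cauchy sequences with all terms in `M_i`. -/
def completionBall (i : ℕ) : ObjectProperty (ModCat C) :=
  fun F => ∃ E : ℕ ⥤ C, D.IsCauchy M E ∧ (∀ n, M i (E.obj n)) ∧ Nonempty (ColimPres E F)

/-- `f_*, g_*, h_*` form a Cauchy sequence of distinguished triangles
`a_* ⟶ b_* ⟶ c_* ⟶ Σa_*`. -/
structure IsCauchyTriangles {a b c : ℕ ⥤ C} (f : a ⟶ b) (g : b ⟶ c)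
    (h : c ⟶ a ⋙ D.shift.functor) : Prop where
  cauchy₁ : D.IsCauchy M a
  cauchy₂ : D.IsCauchy M b
  cauchy₃ : D.IsCauchy M c
  dist : ∀ n, D.Dist (f.app n) (g.app n) (h.app n)

/-- The diagram `A ⟶ B ⟶ Z ⟶ ΣA` in `Mod-C` is the colimit of the image under `Y` of the
sequence of triangles `a_* ⟶ b_* ⟶ c_* ⟶ Σa_*`, through the given identifications
`A = colim Y(a_*)`, `B = colim Y(b_*)`, `Z = colim Y(c_*)`. -/
structure IsColimitTriangle {a b c : ℕ ⥤ C} (f : a ⟶ b) (g : b ⟶ c)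
    (h : c ⟶ a ⋙ D.shift.functor) {A B Z : ModCat C} (α : ColimPres a A) (β : ColimPres b B)
    (γ : ColimPres c Z) (F : A ⟶ B) (G : B ⟶ Z) (H : Z ⟶ D.modShift.functor.obj A) : Prop where
  comm₁ : ∀ n, α.leg n ≫ F = (Y C).map (f.app n) ≫ β.leg n
  comm₂ : ∀ n, β.leg n ≫ G = (Y C).map (g.app n) ≫ γ.leg n
  comm₃ : ∀ n, γ.leg n ≫ H = (Y C).map (h.app n) ≫
    D.yonedaShift.hom.app (a.obj n) ≫ D.modShift.functor.map (α.leg n)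

/-- A strong triangle in `𝔏(C)`: a diagram `A ⟶ B ⟶ Z ⟶ ΣA` which is the colimit of the image
under `Y` of a Cauchy sequence of distinguished triangles. -/
def IsStrongTriangle {A B Z : ModCat C} (F : A ⟶ B) (G : B ⟶ Z)
    (H : Z ⟶ D.modShift.functor.obj A) : Prop :=
  ∃ (a b c : ℕ ⥤ C) (f : a ⟶ b) (g : b ⟶ c) (h : c ⟶ a ⋙ D.shift.functor)
    (α : ColimPres a A) (β : ColimPres b B) (γ : ColimPres c Z),
    D.IsCauchyTriangles M f g h ∧ D.IsColimitTriangle f g h α β γ F G H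

/-- A map of Cauchy sequences `f_* : a_* ⟶ b_*` is of type `n` if, in any completion to a Cauchy
sequence of distinguished triangles `a_* ⟶ b_* ⟶ c_* ⟶ Σa_*`, one has `c_i ∈ M_n` for `i ≫ 0`. -/
def IsTypeSeq (n : ℕ) {a b : ℕ ⥤ C} (f : a ⟶ b) : Prop :=
  ∀ (c : ℕ ⥤ C) (g : b ⟶ c) (h : c ⟶ a ⋙ D.shift.functor), D.IsCauchyTriangles M f g h →
    ∃ N : ℕ, ∀ i, N ≤ i → M n (c.obj i)

/-- Let `A = colim Y(a_*)` and `B = colim Y(b_*)`. A morphism `F : A ⟶ B` is of type `n` with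
respect to `(a_*, b_*)` if `F = colim Y(f_*)` for some map `f_*` of type `n` from a subsequence
of `a_*` to a subsequence of `b_*`. -/
def IsType (n : ℕ) {a b : ℕ ⥤ C} {A B : ModCat C} (α : ColimPres a A) (β : ColimPres b B)
    (F : A ⟶ B) : Prop :=
  ∃ (p q : ℕ → ℕ) (hp : StrictMono p) (hq : StrictMono q)
    (f : hp.monotone.functor ⋙ a ⟶ hq.monotone.functor ⋙ b),
    (∀ k, α.leg (p k) ≫ F = (Y C).map (f.app k) ≫ β.leg (q k)) ∧ D.IsTypeSeq M n f

end TriangleData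

end Completion

/-! ### Good metrics, and the triangulated category `𝔖(S)` -/

/-- A good metric on a triangulated category: full subcategories `M_i` containing `0`, with
`Σ⁻¹M_{i+1} ∪ M_{i+1} ∪ ΣM_{i+1} ⊆ M_i` and `M_i * M_i ⊆ M_i`. -/
structure GoodMetric (S : Type u) [Category.{v} S] [Preadditive S] [HasZeroObject S]
    [HasShift S ℤ] [∀ n : ℤ, (shiftFunctor S n).Additive] [Pretriangulated S] where
  /-- The full subcategories `M_i`. -/
  M : ℕ → ObjectProperty S
  zero_mem : ∀ (i : ℕ) (X : S), IsZero X → M i X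
  mem_of_succ : ∀ (i : ℕ) (X : S), M (i + 1) X → M i X
  shift_mem : ∀ (i : ℕ) (X : S), M (i + 1) X → M i (X⟦(1 : ℤ)⟧)
  shift_neg_mem : ∀ (i : ℕ) (X : S), M (i + 1) X → M i (X⟦(-1 : ℤ)⟧)
  ext_mem : ∀ (i : ℕ) (T : Triangle S), T ∈ distTriang S → M i T.obj₁ → M i T.obj₃ → M i T.obj₂

namespace GoodMetric

variable {S : Type u} [Category.{v} S] [Preadditive S] [HasZeroObject S]
  [HasShift S ℤ] [∀ n : ℤ, (shiftFunctor S n).Additive] [Pretriangulated S]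

variable (m : GoodMetric S)

/-- The suspension and distinguished triangles of `S`. -/
abbrev data (_ : GoodMetric S) : TriangleData S :=
  TriangleData.ofPretriangulated S

/-- `ℭ(S)`: the union over `i` of the orthogonals `Y(M_i)^⊥` in `Mod-S`. -/
def compactlySupported : ObjectProperty (ModCat S) :=
  fun F => ∃ i : ℕ, ∀ X : S, m.M i X → ∀ φ : (Y S).obj X ⟶ F, φ = 0

/-- `𝔏(S)` as a class of objects of `Mod-S`. -/
def fl : ObjectProperty (ModCat S) := m.data.completion m.M

/-- `𝔏_i` as a class of objects of `Mod-S`. -/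
def flBall (i : ℕ) : ObjectProperty (ModCat S) := m.data.completionBall m.M i

/-- `𝔖(S) = 𝔏(S) ∩ ℭ(S)` as a class of objects of `Mod-S`. -/
def fs : ObjectProperty (ModCat S) :=
  fun F => m.fl F ∧ m.compactlySupported F

lemma fs_iso {F G : ModCat S} (e : F ≅ G) (hF : m.fs F) : m.fs G := by
  obtain ⟨⟨E, hE, ⟨p⟩⟩, i, hi⟩ := hF
  refine ⟨⟨E, hE, ⟨⟨p.ι ≫ (Functor.const ℕ).map e.hom, ?_⟩⟩⟩, i, fun X hX φ => ?_⟩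
  · exact p.isColimit.ofIsoColimit (Cocone.ext e)
  · have := hi X hX (φ ≫ e.inv)
    simpa using congr($this ≫ e.hom)

instance : m.fs.IsClosedUnderIsomorphisms where
  of_iso e h := m.fs_iso e h

/-- `Y` commutes with desuspension. -/
def yonedaShiftInv (D : TriangleData S) :
    D.shift.inverse ⋙ Y S ≅ Y S ⋙ D.modShift.inverse :=
  (Functor.rightUnitor _).symm ≪≫
    Functor.isoWhiskerLeft (D.shift.inverse ⋙ Y S) D.modShift.unitIso ≪≫
    Functor.isoWhiskerRight (Functor.isoWhiskerLeft D.shift.inverse D.yonedaShift.symm)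
      D.modShift.inverse ≪≫
    Functor.isoWhiskerRight D.shift.counitIso (Y S ⋙ D.modShift.inverse) ≪≫
    Functor.leftUnitor _

lemma shift_dist (n : ℤ) {X Y Z : S} {f : X ⟶ Y} {g : Y ⟶ Z} {h : Z ⟶ X⟦(1 : ℤ)⟧}
    (hd : Triangle.mk f g h ∈ distTriang S) :
    Triangle.mk (f⟦n⟧') (g⟦n⟧') (n.negOnePow • h⟦n⟧' ≫ (shiftFunctorComm S 1 n).hom.app X) ∈
      distTriang S := by
  refine isomorphic_distinguished _ (Triangle.shift_distinguished _ hd n) _ ?_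
  refine Triangle.isoMk _ _ (Iso.refl _) (n.negOnePow • Iso.refl (Y⟦n⟧)) (Iso.refl _) ?_ ?_ ?_
  · change f⟦n⟧' ≫ (n.negOnePow • 𝟙 (Y⟦n⟧)) = 𝟙 (X⟦n⟧) ≫ (n.negOnePow • f⟦n⟧')
    simp [Units.smul_def]
  · change g⟦n⟧' ≫ 𝟙 (Z⟦n⟧) = (n.negOnePow • 𝟙 (Y⟦n⟧)) ≫ (n.negOnePow • g⟦n⟧')
    obtain h | h := Int.even_or_odd n
    · simp [Int.negOnePow_even n h]
    · simp [Int.negOnePow_odd n h]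
  · change (n.negOnePow • h⟦n⟧' ≫ (shiftFunctorComm S 1 n).hom.app X) ≫ (𝟙 (X⟦n⟧))⟦(1 : ℤ)⟧' =
      𝟙 (Z⟦n⟧) ≫ (n.negOnePow • h⟦n⟧' ≫ (shiftFunctorComm S 1 n).hom.app X)
    rw [CategoryTheory.Functor.map_id]
    exact (Category.comp_id _).trans (Category.id_comp _).symm

lemma isCauchy_shift (n : ℤ) (hn : ∀ (i : ℕ) (X : S), m.M (i + 1) X → m.M i (X⟦n⟧))
    {E : ℕ ⥤ S} (hE : m.data.IsCauchy m.M E) :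
    m.data.IsCauchy m.M (E ⋙ shiftFunctor S n) := by
  intro i
  obtain ⟨N, hN⟩ := hE (i + 1)
  refine ⟨N, fun k k' hk h => ?_⟩
  obtain ⟨Z, g, w, hd, hZ⟩ := hN k k' hk h
  exact ⟨Z⟦n⟧, g⟦n⟧', _, shift_dist n hd, hn i Z hZ⟩

lemma fl_of_iso (T : S ⥤ S) (L : ModCat S ⥤ ModCat S) [L.IsEquivalence]
    (e : T ⋙ Y S ≅ Y S ⋙ L)
    (hT : ∀ E, m.data.IsCauchy m.M E → m.data.IsCauchy m.M (E ⋙ T))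
    {F : ModCat S} (hF : m.fl F) : m.fl (L.obj F) := by
  obtain ⟨E, hE, ⟨p⟩⟩ := hF
  refine ⟨E ⋙ T, hT E hE, ⟨⟨Functor.whiskerLeft E e.hom ≫ Functor.whiskerRight p.ι L ≫
    { app := fun _ => 𝟙 _ }, ?_⟩⟩⟩
  have := isColimitOfPreserves L p.isColimit
  refine ((IsColimit.precomposeHomEquiv (Functor.isoWhiskerLeft E e) _).symm this).ofIsoColimit
    (Cocone.ext (Iso.refl _) ?_)
  intro n
  simp

lemma compactlySupported_of_iso (T : S ⥤ S) (L : ModCat S ≌ ModCat S)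
    (e : T ⋙ Y S ≅ Y S ⋙ L.inverse) (hT : ∀ (i : ℕ) (X : S), m.M (i + 1) X → m.M i (T.obj X))
    {F : ModCat S} (hF : m.compactlySupported F) : m.compactlySupported (L.functor.obj F) := by
  obtain ⟨i, hi⟩ := hF
  refine ⟨i + 1, fun X hX φ => L.inverse.map_injective ?_⟩
  have h := hi _ (hT i X hX) (e.hom.app X ≫ L.inverse.map φ ≫ L.unitIso.inv.app F)
  rw [Functor.map_zero]
  have h₂ := congr(e.inv.app X ≫ $h ≫ L.unitIso.hom.app F)
  simpa using h₂

lemma fs_shift (F : ModCat S) (hF : m.fs F) : m.fs (m.data.modShift.functor.obj F) :=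
  ⟨m.fl_of_iso _ _ m.data.yonedaShift (fun _ h => m.isCauchy_shift 1 m.shift_mem h) hF.1,
    m.compactlySupported_of_iso _ _ (yonedaShiftInv m.data) m.shift_neg_mem hF.2⟩

lemma fs_shift_inv (F : ModCat S) (hF : m.fs F) : m.fs (m.data.modShift.inverse.obj F) :=
  ⟨m.fl_of_iso _ _ (yonedaShiftInv m.data)
      (fun _ h => m.isCauchy_shift (-1) m.shift_neg_mem h) hF.1,
    m.compactlySupported_of_iso _ m.data.modShift.symm m.data.yonedaShift m.shift_mem hF.2⟩

lemma fs_inverseImage : m.fs.inverseImage m.data.modShift.functor = m.fs := by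
  ext F
  refine ⟨fun h => ?_, m.fs_shift F⟩
  exact m.fs_iso (m.data.modShift.unitIso.app F).symm (m.fs_shift_inv _ h)

/-- The category `𝔖(S)`, a full subcategory of `Mod-S`. -/
abbrev FS : Type (max u (v + 1)) := m.fs.FullSubcategory

/-- The suspension and distinguished triangles of `𝔖(S)`: the suspension is the restriction of the
one of `Mod-S`, and the distinguished triangles are the strong triangles of `𝔏(S)` all of whose
terms lie in `𝔖(S)`. -/
def fsData : TriangleData m.FS where
  shift := m.data.modShift.congrFullSubcategory m.fs_inverseImage
  additive :=
    { map_add := by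
        intros; rfl }
  Dist f g h := m.data.IsStrongTriangle m.M f.hom g.hom h.hom

/-- The good metric `{𝔑_i}` on `𝔖(S)`, where `𝔑_i = 𝔏_i ∩ 𝔖(S)`. -/
def fsBall (i : ℕ) : ObjectProperty m.FS :=
  fun F => m.flBall i F.obj

/-- The metric `{𝔑_i^op}` on `𝔖(S)^op`. -/
def fsOpBall (i : ℕ) : ObjectProperty m.FSᵒᵖ :=
  (m.fsBall i).op

/-! ### Excellent metrics -/

/-- The metric is excellent. -/
structure IsExcellent : Prop where
  /-- `S` is the union of the `^⊥M_i`. -/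
  left_orth : ∀ X : S, ∃ i : ℕ, ∀ Z : S, m.M i Z → ∀ φ : X ⟶ Z, φ = 0
  /-- For every `k` there is `n > k` such that every `F ∈ S` sits in a triangle
  `E ⟶ F ⟶ D ⟶ ΣE` with `E ∈ ^⊥M_n` and `D ∈ M_k`. -/
  approx : ∀ k : ℕ, ∃ n : ℕ, k < n ∧ ∀ F : S,
    ∃ (E D : S) (f : E ⟶ F) (g : F ⟶ D) (h : D ⟶ E⟦(1 : ℤ)⟧), Triangle.mk f g h ∈ distTriang S ∧
      (∀ Z : S, m.M n Z → ∀ φ : E ⟶ Z, φ = 0) ∧ m.M k D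
  /-- For every `k` there is `n > k` such that every `F ∈ S` admits a morphism `Y(F) ⟶ D` of
  type `k` with respect to `(F, d_*)`, where `F` stands for the constant sequence,
  `D = colim Y(d_*)` for a Cauchy sequence `d_*`, and `D ∈ 𝔖(S) ∩ 𝔏_n^⊥`. -/
  coapprox : ∀ k : ℕ, ∃ n : ℕ, k < n ∧ ∀ F : S, ∃ (d : ℕ ⥤ S) (D : ModCat S)
    (δ : ColimPres d D) (φ : (Y S).obj F ⟶ D),
    m.data.IsCauchy m.M d ∧ m.data.IsType m.M k (ColimPres.const F) δ φ ∧
    m.fs D ∧ ∀ G : ModCat S, m.flBall n G → ∀ ψ : G ⟶ D, ψ = 0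

/-! ### The functor `Ŷ` -/

/-- `Ŷ : (Mod-S)^op ⥤ Mod-𝔖(S)^op`, sending `F` to the restriction of `Hom(F, -)` to `𝔖(S)`. -/
def yhat : (ModCat S)ᵒᵖ ⥤ ModCat m.FSᵒᵖ :=
  preadditiveCoyoneda ⋙ (Functor.whiskeringLeft _ _ _).obj (unopUnop m.FS ⋙ m.fs.ι)

/-- The canonical identification of `Ŷ(F)` with the suspension of `Ŷ(ΣF)` in `Mod-𝔖(S)^op`,
given at `Z ∈ 𝔖(S)` by the isomorphism `Σ : Hom(F, Z) ≅ Hom(ΣF, ΣZ)`. (The suspension of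
`𝔖(S)^op` is `Σ⁻¹`, so the suspension of `Mod-𝔖(S)^op` is precomposition with `Σ`.) -/
def yhatShift (F : ModCat S) :
    m.yhat.obj (op F) ≅
      m.fsData.op.modShift.functor.obj (m.yhat.obj (op (m.data.modShift.functor.obj F))) :=
  NatIso.ofComponents
    (fun Z => (AddEquiv.toAddCommGrpIso
      (X := AddCommGrpCat.of (F ⟶ Z.unop.unop.obj))
      (Y := AddCommGrpCat.of (m.data.modShift.functor.obj F ⟶
        m.data.modShift.functor.obj Z.unop.unop.obj))
      { m.data.modShift.fullyFaithfulFunctor.homEquiv with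
        map_add' := fun φ ψ => by rfl } :))
    (fun {Z W} f => by
      ext (φ : F ⟶ Z.unop.unop.obj)
      exact Functor.map_comp m.data.modShift.functor φ f.unop.unop.hom)

/-! ### Inverse sequences in `𝔖(S)` -/

/-- The data exhibiting `F` as the limit in `Mod-S` of an inverse sequence
`⋯ ⟶ x_2 ⟶ x_1 ⟶ x_0` in `𝔖(S)`. -/
structure LimPres (x : ℕᵒᵖ ⥤ m.FS) (F : ModCat S) where
  /-- The limit cone. -/
  π : (Functor.const ℕᵒᵖ).obj F ⟶ x ⋙ m.fs.ι
  isLimit : IsLimit (Cone.mk F π)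

variable {m} in
/-- The projection `F ⟶ x_n`. -/
def LimPres.proj {x : ℕᵒᵖ ⥤ m.FS} {F : ModCat S} (p : m.LimPres x F) (n : ℕ) :
    F ⟶ (x.obj (op n)).obj :=
  p.π.app (op n)

/-- An inverse sequence in `𝔖(S)` is Cauchy if it is a Cauchy sequence in `𝔖(S)^op` with respect
to the metric `{𝔑_i^op}`. -/
def IsInverseCauchy (x : ℕᵒᵖ ⥤ m.FS) : Prop :=
  m.fsData.op.IsCauchy m.fsOpBall x.rightOp

/-- `a_* ⟶ b_* ⟶ c_* ⟶ Σa_*` is an inverse sequence of distinguished triangles in `𝔖(S)`, and it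
is Cauchy when viewed as a sequence of triangles in `𝔖(S)^op`. -/
structure IsInverseCauchyTriangles {a b c : ℕᵒᵖ ⥤ m.FS} (f : a ⟶ b) (g : b ⟶ c)
    (h : c ⟶ a ⋙ m.fsData.shift.functor) : Prop where
  cauchy₁ : m.IsInverseCauchy a
  cauchy₂ : m.IsInverseCauchy b
  cauchy₃ : m.IsInverseCauchy c
  dist : ∀ n, m.fsData.Dist (f.app n) (g.app n) (h.app n)

/-- The diagram `A ⟶ B ⟶ Z ⟶ ΣA` is the limit in `Mod-S` of the inverse sequence of triangles
`a_* ⟶ b_* ⟶ c_* ⟶ Σa_*`, through the given identifications `A = lim a_*`, `B = lim b_*`,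
`Z = lim c_*`. -/
structure IsLimitTriangle {a b c : ℕᵒᵖ ⥤ m.FS} (f : a ⟶ b) (g : b ⟶ c)
    (h : c ⟶ a ⋙ m.fsData.shift.functor) {A B Z : ModCat S} (α : m.LimPres a A)
    (β : m.LimPres b B) (γ : m.LimPres c Z) (F : A ⟶ B) (G : B ⟶ Z)
    (H : Z ⟶ m.data.modShift.functor.obj A) : Prop where
  comm₁ : ∀ n, α.proj n ≫ (f.app (op n)).hom = F ≫ β.proj n
  comm₂ : ∀ n, β.proj n ≫ (g.app (op n)).hom = G ≫ γ.proj n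
  comm₃ : ∀ n, γ.proj n ≫ (h.app (op n)).hom = H ≫ m.data.modShift.functor.map (α.proj n)

end GoodMetric

end ExcellentMetric

/-!
The triangle `A ⟶ B ⟶ C ⟶ ΣA` is approximated from the right by distinguished triangles of `𝔖(S)`. A
morphism `F : colim Y(a_*) ⟶ colim Y(b_*)` is given the type `k` (`GoodMetric.HasType`) if all late
enough maps `a_n ⟶ b_q` representing it have their cones in `M_k`; by the octahedral axiom a single
late representative decides this (`hasType_of_represents`). Objects of `𝔖(S)` are cohomological
functors orthogonal to some `M_r`, so a morphism `A ⟶ D` of type `r + 1` induces a bijection on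
morphisms to such an object (`HasType.hom_injective`, `HasType.exists_extension`). Dually, if
`Hom(X, M_i) = 0`, a morphism of type `i + 1` is bijective on sections over `X`
(`HasType.bijective_app`).

The third axiom of excellence, applied to a late term of `a_*`, gives morphisms of arbitrarily high
type from `A` to objects of `𝔖(S)` (`exists_object_approx`). For a triangle
(`exists_triangle_approx`) one first chooses `B ⟶ B₁`, which is the identity if `B` is in `𝔖(S)`,
and then `A ⟶ A₁` of type high enough for `A ⟶ B ⟶ B₁` to factor uniquely through `A₁`. Completing
`A₁ ⟶ B₁` on the level of Cauchy sequences gives `C₁`. Since maps from `C` to an object of `𝔖(S)`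
are determined by any late `Y(c_n)`, a single completion `c_n ⟶ c₁_l` of a commutative square to a
map of triangles yields `C ⟶ C₁`; no compatible choice of such completions is needed. That its cone
is small is the content of `exists_good_fill`.

Repeating this with rapidly increasing types, each approximation factors uniquely through the next
one, which gives the transition morphisms and all their commutation relations (`TriangleTower`). The
transition morphisms are of high type, so their fibers are in small balls and the tower is Cauchy in
`𝔖(S)^op` (`Tower.isInverseCauchy`). Over a given object of `S` the tower is eventually constant, so
its limit is the given triangle (`Tower.limPres`); against a given object of `𝔖(S)` it is eventually
constant as well, so `Ŷ` takes the triangle to the colimit of the tower (`Tower.yhatPres`).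
-/

namespace ExcellentMetric

/-! ### Morphisms whose cone lies in a term of a good metric -/

namespace GoodMetric

variable {S : Type u} [Category.{v} S] [Preadditive S] [HasZeroObject S]
  [HasShift S ℤ] [∀ n : ℤ, (shiftFunctor S n).Additive] [Pretriangulated S]
  (m : GoodMetric S)

/-- The cone of `x` lies in `M_i`. -/
def ConeMem (i : ℕ) {X Y : S} (x : X ⟶ Y) : Prop :=
  ∃ (Z : S) (g : Y ⟶ Z) (k : Z ⟶ X⟦(1 : ℤ)⟧), Triangle.mk x g k ∈ distTriang S ∧ m.M i Z

variable {m}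

lemma coneMem_of_isIso (i : ℕ) {X Y : S} (x : X ⟶ Y) [IsIso x] : m.ConeMem i x := by
  obtain ⟨Z, g, k, hT⟩ := distinguished_cocone_triangle x
  exact ⟨Z, g, k, hT, m.zero_mem i _ ((Triangle.isZero₃_iff_isIso₁ _ hT).2 ‹_›)⟩

lemma coneMem_id (i : ℕ) (X : S) : m.ConeMem i (𝟙 X) :=
  coneMem_of_isIso i _

lemma ConeMem.mem_target {i : ℕ} {X Y : S} {x : X ⟶ Y} (hx : m.ConeMem i x) (hX : m.M i X) :
    m.M i Y := by
  obtain ⟨Z, g, k, hT, hZ⟩ := hx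
  exact m.ext_mem i _ hT hX hZ

lemma mem_of_iso {i : ℕ} {X Y : S} (e : X ≅ Y) (hX : m.M i X) : m.M i Y :=
  (coneMem_of_isIso i e.hom).mem_target hX

lemma mem_mono {i j : ℕ} (hij : i ≤ j) {X : S} (hX : m.M j X) : m.M i X := by
  induction j, hij using Nat.le_induction with
  | base => exact hX
  | succ j _ ih => exact ih (m.mem_of_succ j X hX)

lemma ConeMem.mem {i : ℕ} {X Y Z : S} {x : X ⟶ Y} (hx : m.ConeMem i x) {g : Y ⟶ Z}
    {k : Z ⟶ X⟦(1 : ℤ)⟧} (hT : Triangle.mk x g k ∈ distTriang S) : m.M i Z := by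
  obtain ⟨Z', g', k', hT', hZ'⟩ := hx
  exact mem_of_iso (Triangle.π₃.mapIso
    (isoTriangleOfIso₁₂ _ _ hT' hT (Iso.refl _) (Iso.refl _)
      ((Category.comp_id _).trans (Category.id_comp _).symm))) hZ'

lemma ConeMem.mono {i j : ℕ} (hij : i ≤ j) {X Y : S} {x : X ⟶ Y} (hx : m.ConeMem j x) :
    m.ConeMem i x := by
  obtain ⟨Z, g, k, hT, hZ⟩ := hx
  exact ⟨Z, g, k, hT, mem_mono hij hZ⟩

lemma ConeMem.shift {i : ℕ} {X Y : S} {x : X ⟶ Y} (hx : m.ConeMem (i + 1) x) :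
    m.ConeMem i (x⟦(1 : ℤ)⟧') := by
  obtain ⟨Z, g, k, hT, hZ⟩ := hx
  exact ⟨_, _, _, shift_dist 1 hT, m.shift_mem i Z hZ⟩

lemma coneMem_of_isCauchy {E : ℕ ⥤ S} (hE : m.data.IsCauchy m.M E) (i : ℕ) :
    ∃ N, ∀ (n n' : ℕ) (_ : N ≤ n) (h : n ≤ n'), m.ConeMem i (E.map (homOfLE h)) := by
  obtain ⟨N, hN⟩ := hE i
  refine ⟨N, fun n n' hn h => ?_⟩
  obtain rfl | h' := h.eq_or_lt
  · simpa using coneMem_id i _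
  · exact hN n n' hn h'

lemma isCauchy_subseq {E : ℕ ⥤ S} (hE : m.data.IsCauchy m.M E) {p : ℕ → ℕ} (hp : StrictMono p) :
    m.data.IsCauchy m.M (hp.monotone.functor ⋙ E) := by
  intro i
  obtain ⟨N, hN⟩ := hE i
  exact ⟨N, fun n n' hn h => hN (p n) (p n') (hn.trans (hp.id_le n)) (hp h)⟩

variable [IsTriangulated S]

lemma ConeMem.comp {i : ℕ} {X Y Z : S} {x : X ⟶ Y} {y : Y ⟶ Z} (hx : m.ConeMem i x)
    (hy : m.ConeMem i y) : m.ConeMem i (x ≫ y) := by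
  obtain ⟨_, _, _, hT₁, h₁⟩ := hx
  obtain ⟨_, _, _, hT₂, h₂⟩ := hy
  obtain ⟨W, g, k, hT⟩ := distinguished_cocone_triangle (x ≫ y)
  have o := Triangulated.someOctahedron rfl hT₁ hT₂ hT
  exact ⟨W, g, k, hT, m.ext_mem i _ o.mem h₁ h₂⟩

/-- The loss of one index is due to the suspension of the cone of `x` in the rotated triangle of
cones. -/
lemma ConeMem.of_comp_left {i : ℕ} {X Y Z : S} {x : X ⟶ Y} {y : Y ⟶ Z}
    (hx : m.ConeMem (i + 1) x) (hxy : m.ConeMem i (x ≫ y)) : m.ConeMem i y := by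
  obtain ⟨_, _, _, hT₁, h₁⟩ := hx
  obtain ⟨_, _, _, hT₂, h₂⟩ := hxy
  obtain ⟨W, g, k, hT⟩ := distinguished_cocone_triangle y
  have o := Triangulated.someOctahedron rfl hT₁ hT hT₂
  exact ⟨W, g, k, hT, m.ext_mem i _ (rot_of_distTriang _ o.mem) h₂ (m.shift_mem i _ h₁)⟩

lemma ConeMem.of_comp_right {i : ℕ} {X Y Z : S} {x : X ⟶ Y} {y : Y ⟶ Z}
    (hy : m.ConeMem (i + 1) y) (hxy : m.ConeMem i (x ≫ y)) : m.ConeMem i x := by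
  obtain ⟨_, _, _, hT₁, h₁⟩ := hy
  obtain ⟨_, _, _, hT₂, h₂⟩ := hxy
  obtain ⟨W, g, k, hT⟩ := distinguished_cocone_triangle x
  have o := Triangulated.someOctahedron rfl hT hT₁ hT₂
  exact ⟨W, g, k, hT, m.ext_mem i _ (inv_rot_of_distTriang _ o.mem) (m.shift_neg_mem i _ h₁) h₂⟩

/-- A commutative square can be completed to a morphism of triangles whose third component has its
cone controlled by the cones of the first two. It is the composite of the maps provided by two
octahedra on the diagonal `a ⟶ b'` of the square. -/
lemma exists_good_fill {a b c a' b' c' : S} {f : a ⟶ b} {g : b ⟶ c} {h : c ⟶ a⟦(1 : ℤ)⟧}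
    {f' : a' ⟶ b'} {g' : b' ⟶ c'} {h' : c' ⟶ a'⟦(1 : ℤ)⟧}
    (hT : Triangle.mk f g h ∈ distTriang S) (hT' : Triangle.mk f' g' h' ∈ distTriang S)
    (x : a ⟶ a') (y : b ⟶ b') (w : f ≫ y = x ≫ f') :
    ∃ z : c ⟶ c', g ≫ z = y ≫ g' ∧ h ≫ x⟦(1 : ℤ)⟧' = z ≫ h' ∧
      ∀ (m : GoodMetric S) (i : ℕ), m.ConeMem (i + 1) x → m.ConeMem i y → m.ConeMem i z := by
  obtain ⟨X, gx, kx, hX⟩ := distinguished_cocone_triangle x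
  obtain ⟨Y, gy, ky, hY⟩ := distinguished_cocone_triangle y
  obtain ⟨W, g₀, h₀, hW⟩ := distinguished_cocone_triangle (f ≫ y)
  have o₁ := Triangulated.someOctahedron rfl hT hY hW
  have o₂ := Triangulated.someOctahedron w.symm hX hT' hW
  refine ⟨o₁.m₁ ≫ o₂.m₃, ?_, ?_, fun m i hx hy => ?_⟩
  · rw [o₁.comm₁_assoc, o₂.comm₃]
  · rw [Category.assoc, ← o₂.comm₄, o₁.comm₂_assoc]
  · exact ConeMem.comp ⟨_, _, _, o₁.mem, hy.mem hY⟩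
      ⟨_, _, _, rot_of_distTriang _ o₂.mem, m.shift_mem i _ (hx.mem hX)⟩

/-! ### Cauchy sequences -/

lemma coneMem_map_of_succ {E : ℕ ⥤ S} {i N : ℕ}
    (hE : ∀ n, N ≤ n → m.ConeMem i (E.map (homOfLE (Nat.le_add_right n 1)))) {n n' : ℕ}
    (hn : N ≤ n) (h : n ≤ n') : m.ConeMem i (E.map (homOfLE h)) := by
  induction n', h using Nat.le_induction with
  | base => simpa using coneMem_id i _
  | succ k hk ih =>
    have := ih.comp (hE k (hn.trans hk))
    rwa [← E.map_comp, homOfLE_comp] at this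

/-- Since the `M_i` are closed under extensions, the Cauchy condition can be checked on successive
terms. -/
lemma isCauchy_of_succ {E : ℕ ⥤ S}
    (hE : ∀ i, ∃ N, ∀ n, N ≤ n → m.ConeMem i (E.map (homOfLE (Nat.le_add_right n 1)))) :
    m.data.IsCauchy m.M E := by
  intro i
  obtain ⟨N, hN⟩ := hE i
  exact ⟨N, fun n n' hn h => coneMem_map_of_succ hN hn h.le⟩

/-- Every map of Cauchy sequences has a completion to a Cauchy sequence of triangles. -/
lemma exists_completion {a b : ℕ ⥤ S} (ha : m.data.IsCauchy m.M a) (hb : m.data.IsCauchy m.M b)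
    (f : a ⟶ b) : ∃ (c : ℕ ⥤ S) (g : b ⟶ c) (h : c ⟶ a ⋙ m.data.shift.functor),
      m.data.IsCauchyTriangles m.M f g h := by
  choose c g h hT using fun n => distinguished_cocone_triangle (f.app n)
  choose z hz₁ hz₂ hz₃ using fun n : ℕ => exists_good_fill (hT n) (hT (n + 1))
    (a.map (homOfLE (Nat.le_add_right n 1))) (b.map (homOfLE (Nat.le_add_right n 1)))
    (f.naturality _).symm
  refine ⟨Functor.ofSequence z, NatTrans.ofSequence g fun n => ?_,
    NatTrans.ofSequence h fun n => ?_, ha, hb, isCauchy_of_succ fun i => ?_, hT⟩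
  · rw [Functor.ofSequence_map_homOfLE_succ]
    exact (hz₁ n).symm
  · rw [Functor.ofSequence_map_homOfLE_succ]
    exact (hz₂ n).symm
  · obtain ⟨N₁, h₁⟩ := coneMem_of_isCauchy ha (i + 1)
    obtain ⟨N₂, h₂⟩ := coneMem_of_isCauchy hb i
    refine ⟨max N₁ N₂, fun n hn => ?_⟩
    rw [Functor.ofSequence_map_homOfLE_succ]
    exact hz₃ n m i (h₁ _ _ (by omega) _) (h₂ _ _ (by omega) _)

end GoodMetric

/-! ### Sequential colimits of representables -/

lemma yoneda_hom_ext {C : Type u} [Category.{v} C] [Preadditive C] {X : C} {F : ModCat C}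
    {φ ψ : (Y C).obj X ⟶ F} (h : φ.app (op X) (𝟙 X) = ψ.app (op X) (𝟙 X)) : φ = ψ := by
  ext Z (x : Z.unop ⟶ X)
  have h₁ : φ.app Z (x ≫ 𝟙 X) = F.map x.op (φ.app (op X) (𝟙 X)) :=
    ConcreteCategory.congr_hom (φ.naturality x.op) (𝟙 X)
  have h₂ : ψ.app Z (x ≫ 𝟙 X) = F.map x.op (ψ.app (op X) (𝟙 X)) :=
    ConcreteCategory.congr_hom (ψ.naturality x.op) (𝟙 X)
  rw [Category.comp_id] at h₁ h₂
  exact h₁.trans ((congrArg _ h).trans h₂.symm)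

instance : PreservesFilteredColimitsOfSize.{0, 0} (forget AddCommGrpCat.{v}) :=
  preservesFilteredColimitsOfSize_shrink.{0, v, 0, v} _

namespace ColimPres

variable {C : Type u} [Category.{v} C] [Preadditive C] {E : ℕ ⥤ C} {F : ModCat C}

lemma map_leg (p : ColimPres E F) {n n' : ℕ} (h : n ≤ n') :
    (Y C).map (E.map (homOfLE h)) ≫ p.leg n' = p.leg n :=
  (p.ι.naturality (homOfLE h)).trans (Category.comp_id _)

lemma hom_ext (p : ColimPres E F) {G : ModCat C} {φ ψ : F ⟶ G}
    (h : ∀ n, p.leg n ≫ φ = p.leg n ≫ ψ) : φ = ψ :=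
  p.isColimit.hom_ext h

lemma exists_desc (p : ColimPres E F) {G : ModCat C} (φ : ∀ n, (Y C).obj (E.obj n) ⟶ G)
    (h : ∀ n, (Y C).map (E.map (homOfLE (Nat.le_add_right n 1))) ≫ φ (n + 1) = φ n) :
    ∃ ψ : F ⟶ G, ∀ n, p.leg n ≫ ψ = φ n :=
  ⟨p.isColimit.desc (Cocone.mk G (NatTrans.ofSequence (G := (Functor.const ℕ).obj G) φ
    fun n => (h n).trans (Category.comp_id _).symm)), fun n => p.isColimit.fac _ n⟩

/-- Transport of a presentation along an isomorphism of the colimits. -/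
def ofIso (p : ColimPres E F) {G : ModCat C} (e : F ≅ G) : ColimPres E G where
  ι := p.ι ≫ (Functor.const ℕ).map e.hom
  isColimit := p.isColimit.ofIsoColimit (Cocone.ext e)

@[simp]
lemma ofIso_leg (p : ColimPres E F) {G : ModCat C} (e : F ≅ G) (n : ℕ) :
    (p.ofIso e).leg n = p.leg n ≫ e.hom := rfl

/-- A subsequence has the same colimit. -/
noncomputable def subseq (p : ColimPres E F) {k : ℕ → ℕ} (hk : StrictMono k) :
    ColimPres (hk.monotone.functor ⋙ E) F where
  ι := { app := fun n => p.leg (k n)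
         naturality := fun n n' f => by simpa using! p.ι.naturality (hk.monotone.functor.map f) }
  isColimit := by
    have : hk.monotone.functor.Final :=
      (Monotone.final_functor_iff hk.monotone).2 fun j => ⟨j, hk.id_le j⟩
    exact ((Functor.Final.isColimitWhiskerEquiv hk.monotone.functor (Cocone.mk F p.ι)).symm
      p.isColimit).ofIsoColimit (Cocone.ext (Iso.refl _) fun n => Category.comp_id _)

lemma exists_colimPres (E : ℕ ⥤ C) : ∃ F : ModCat C, Nonempty (ColimPres E F) :=
  ⟨colimit (E ⋙ Y C), ⟨⟨(colimit.cocone (E ⋙ Y C)).ι, colimit.isColimit _⟩⟩⟩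

/-- Every section over `X` comes from a morphism `Y(X) ⟶ F`, which moreover factors through some
`Y(E_q)`. -/
lemma exists_section (p : ColimPres E F) {X : C} (e : F.obj (op X)) :
    ∃ (q : ℕ) (x : X ⟶ E.obj q), ((Y C).map x ≫ p.leg q).app (op X) (𝟙 X) = e := by
  have hc := isColimitOfPreserves ((evaluation _ AddCommGrpCat.{v}).obj (op X)) p.isColimit
  obtain ⟨q, x, hx⟩ := Concrete.isColimit_exists_rep _ hc e
  change X ⟶ E.obj q at x
  exact ⟨q, x, (congrArg ((p.leg q).app (op X)) (Category.id_comp x)).trans hx⟩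

/-- Representables are compact: a morphism to a sequential colimit factors through a stage. -/
lemma exists_lift (p : ColimPres E F) {X : C} (φ : (Y C).obj X ⟶ F) (N : ℕ) :
    ∃ (q : ℕ) (_ : N ≤ q) (x : X ⟶ E.obj q), φ = (Y C).map x ≫ p.leg q := by
  obtain ⟨q, x, hx⟩ := p.exists_section (φ.app (op X) (𝟙 X))
  refine ⟨max N q, le_max_left _ _, x ≫ E.map (homOfLE (le_max_right _ _)), ?_⟩
  rw [Functor.map_comp, Category.assoc, p.map_leg, yoneda_hom_ext hx]

/-- Representables are compact: factorizations through a stage are unique at a later stage. -/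
lemma exists_map_eq (p : ColimPres E F) {X : C} {q : ℕ} {x y : X ⟶ E.obj q}
    (h : (Y C).map x ≫ p.leg q = (Y C).map y ≫ p.leg q) :
    ∃ (q' : ℕ) (hq : q ≤ q'), x ≫ E.map (homOfLE hq) = y ≫ E.map (homOfLE hq) := by
  have hc := isColimitOfPreserves ((evaluation _ AddCommGrpCat.{v}).obj (op X)) p.isColimit
  have h' : (p.leg q).app (op X) (𝟙 X ≫ x) = (p.leg q).app (op X) (𝟙 X ≫ y) :=
    ConcreteCategory.congr_hom (congr_app h (op X)) (𝟙 X)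
  rw [Category.id_comp, Category.id_comp] at h'
  obtain ⟨q', f, g, hfg⟩ := (Concrete.isColimit_rep_eq_iff_exists _ hc x y).1 h'
  obtain rfl : f = g := Subsingleton.elim _ _
  exact ⟨q', leOfHom f, hfg⟩

lemma exists_comp_eq_zero (p : ColimPres E F) {X : C} {q : ℕ} {x : X ⟶ E.obj q}
    (h : (Y C).map x ≫ p.leg q = 0) :
    ∃ (q' : ℕ) (hq : q ≤ q'), x ≫ E.map (homOfLE hq) = 0 := by
  obtain ⟨q', hq, h'⟩ := p.exists_map_eq (x := x) (y := 0) (by simp [h])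
  exact ⟨q', hq, by simpa using h'⟩

/-- The image of a presentation under the suspension. -/
noncomputable def shift (D : TriangleData C) (p : ColimPres E F) :
    ColimPres (E ⋙ D.shift.functor) (D.modShift.functor.obj F) where
  ι := { app := fun n => D.yonedaShift.hom.app (E.obj n) ≫ D.modShift.functor.map (p.leg n)
         naturality := fun n n' f => by
          have h₁ := D.yonedaShift.hom.naturality (E.map f)
          have h₂ := p.ι.naturality f
          dsimp only [Functor.comp_map, Functor.comp_obj, Functor.const_obj_obj,
            Functor.const_obj_map] at h₁ h₂ ⊢
          rw [reassoc_of% h₁, ← D.modShift.functor.map_comp, Category.comp_id]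
          exact congrArg (fun t => _ ≫ D.modShift.functor.map t) (h₂.trans (Category.comp_id _)) }
  isColimit := ((IsColimit.precomposeHomEquiv (Functor.isoWhiskerLeft E D.yonedaShift) _).symm
    (isColimitOfPreserves D.modShift.functor p.isColimit)).ofIsoColimit
      (Cocone.ext (Iso.refl _) fun n => Category.comp_id _)

@[simp]
lemma shift_leg (D : TriangleData C) (p : ColimPres E F) (n : ℕ) :
    (p.shift D).leg n =
      D.yonedaShift.hom.app (E.obj n) ≫ D.modShift.functor.map (p.leg n) := rfl

/-- The identification of `ΣY(Σ⁻¹a)` with `Y(a)`. -/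
noncomputable def shiftYonedaDesuspend (D : TriangleData C) :
    (D.shift.inverse ⋙ Y C) ⋙ D.modShift.functor ≅ Y C :=
  Functor.isoWhiskerLeft D.shift.inverse D.yonedaShift.symm ≪≫
    Functor.isoWhiskerRight D.shift.counitIso (Y C)

/-- The image of a presentation under the desuspension. Its structure morphisms are those taken by
`Σ` to the given ones, up to the identifications of `ΣY(Σ⁻¹a)` with `Y(a)` and of `ΣΣ⁻¹F`
with `F`. -/
noncomputable def desuspend (D : TriangleData C) (p : ColimPres E F) :
    ColimPres (E ⋙ D.shift.inverse) (D.modShift.inverse.obj F) where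
  ι := { app := fun n => D.modShift.functor.preimage
          ((shiftYonedaDesuspend D).hom.app (E.obj n) ≫
            (p.ofIso (D.modShift.counitIso.app F).symm).leg n)
         naturality := fun n n' f => D.modShift.functor.map_injective (by
          have h₁ := (shiftYonedaDesuspend D).hom.naturality (E.map f)
          have h₂ := (p.ofIso (D.modShift.counitIso.app F).symm).ι.naturality f
          dsimp only [Functor.comp_map, Functor.comp_obj, Functor.const_obj_obj,
            Functor.const_obj_map] at h₁ h₂ ⊢
          rw [Functor.map_comp, Functor.map_comp, Functor.map_preimage, Functor.map_preimage,
            reassoc_of% h₁, CategoryTheory.Functor.map_id,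
            Category.comp_id]
          exact congrArg (fun t => _ ≫ t) (h₂.trans (Category.comp_id _))) }
  isColimit := by
    refine isColimitOfReflects D.modShift.functor ?_
    refine ((IsColimit.precomposeHomEquiv
      (Functor.isoWhiskerLeft E (shiftYonedaDesuspend D)) _).symm
        (p.ofIso (D.modShift.counitIso.app F).symm).isColimit).ofIsoColimit
      (Cocone.ext (Iso.refl _) fun n => ?_)
    refine (Category.comp_id _).trans ?_
    exact (D.modShift.functor.map_preimage _).symm

lemma map_desuspend_leg (D : TriangleData C) (p : ColimPres E F) (n : ℕ) :
    D.modShift.functor.map ((p.desuspend D).leg n) =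
      D.yonedaShift.inv.app (D.shift.inverse.obj (E.obj n)) ≫
        (Y C).map (D.shift.counit.app (E.obj n)) ≫ p.leg n ≫ D.modShift.counitInv.app F := by
  refine (D.modShift.functor.map_preimage _).trans ?_
  exact Category.assoc _ _ _

lemma yonedaShift_desuspend_leg (D : TriangleData C) (p : ColimPres E F) (n : ℕ) :
    (Y C).map (D.shift.counitInv.app (E.obj n)) ≫
      D.yonedaShift.hom.app (D.shift.inverse.obj (E.obj n)) ≫
        D.modShift.functor.map ((p.desuspend D).leg n) = p.leg n ≫ D.modShift.counitInv.app F := by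
  have e : (Y C).map (D.shift.counitInv.app (E.obj n)) ≫
      (Y C).map (D.shift.counit.app (E.obj n)) = 𝟙 _ := by
    rw [← Functor.map_comp]
    exact (congrArg _ (D.shift.counitIso.inv_hom_id_app _)).trans
      (CategoryTheory.Functor.map_id _ _)
  rw [map_desuspend_leg, Iso.hom_inv_id_app_assoc, reassoc_of% e]

end ColimPres

section Represents

variable {C : Type u} [Category.{v} C] [Preadditive C] {a b c : ℕ ⥤ C} {A B Z : ModCat C}

/-- `x : a_n ⟶ b_q` represents `F : colim Y(a_*) ⟶ colim Y(b_*)`: it is compatible with `F` through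
the structure morphisms of the colimits. -/
def Represents (α : ColimPres a A) (β : ColimPres b B) (F : A ⟶ B) {n q : ℕ}
    (x : a.obj n ⟶ b.obj q) : Prop :=
  α.leg n ≫ F = (Y C).map x ≫ β.leg q

lemma exists_represents (α : ColimPres a A) (β : ColimPres b B) (F : A ⟶ B) (n N : ℕ) :
    ∃ (q : ℕ) (_ : N ≤ q) (x : a.obj n ⟶ b.obj q), Represents α β F x :=
  β.exists_lift (α.leg n ≫ F) N

lemma Represents.comp_map {α : ColimPres a A} {β : ColimPres b B} {F : A ⟶ B} {n q : ℕ}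
    {x : a.obj n ⟶ b.obj q} (hx : Represents α β F x) {q' : ℕ} (h : q ≤ q') :
    Represents α β F (x ≫ b.map (homOfLE h)) := by
  rw [Represents, Functor.map_comp, Category.assoc, β.map_leg, hx]

lemma Represents.map_comp {α : ColimPres a A} {β : ColimPres b B} {F : A ⟶ B} {n' q : ℕ}
    {x : a.obj n' ⟶ b.obj q} (hx : Represents α β F x) {n : ℕ} (h : n ≤ n') :
    Represents α β F (a.map (homOfLE h) ≫ x) := by
  rw [Represents, Functor.map_comp, Category.assoc, ← hx, ← α.map_leg h, Category.assoc]

lemma Represents.comp {α : ColimPres a A} {β : ColimPres b B} {γ : ColimPres c Z} {F : A ⟶ B}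
    {G : B ⟶ Z} {n q k : ℕ} {x : a.obj n ⟶ b.obj q} {y : b.obj q ⟶ c.obj k}
    (hx : Represents α β F x) (hy : Represents β γ G y) : Represents α γ (F ≫ G) (x ≫ y) := by
  rw [Represents, Functor.map_comp, Category.assoc, ← hy, reassoc_of% (show _ = _ from hx)]

lemma Represents.exists_eq {α : ColimPres a A} {β : ColimPres b B} {F : A ⟶ B} {n q : ℕ}
    {x y : a.obj n ⟶ b.obj q} (hx : Represents α β F x) (hy : Represents α β F y) :
    ∃ (q' : ℕ) (hq : q ≤ q'), x ≫ b.map (homOfLE hq) = y ≫ b.map (homOfLE hq) :=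
  β.exists_map_eq (hx.symm.trans hy)

lemma Represents.shift (D : TriangleData C) {α : ColimPres a A} {β : ColimPres b B} {F : A ⟶ B}
    {n q : ℕ} {x : a.obj n ⟶ b.obj q} (hx : Represents α β F x) :
    Represents (n := n) (q := q) (α.shift D) (β.shift D) (D.modShift.functor.map F)
      (D.shift.functor.map x) := by
  have h := D.yonedaShift.hom.naturality x
  dsimp only [Functor.comp_map, Functor.comp_obj] at h
  rw [Represents, ColimPres.shift_leg, ColimPres.shift_leg, Category.assoc, ← Functor.map_comp,
    show _ = _ from hx, Functor.map_comp]
  exact (Category.assoc _ _ _).symm.trans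
    ((congrArg (· ≫ _) h.symm).trans (Category.assoc _ _ _))

end Represents

/-! ### Orthogonality to the metric, and types of morphisms -/

namespace GoodMetric

variable {S : Type u} [Category.{v} S] [Preadditive S] [HasZeroObject S]
  [HasShift S ℤ] [∀ n : ℤ, (shiftFunctor S n).Additive] [Pretriangulated S]
  {m : GoodMetric S} {a b c : ℕ ⥤ S} {A B Z : ModCat S}

variable (m) in
/-- The class `Y(M_r)^⊥`. -/
def Perp (r : ℕ) : ObjectProperty (ModCat S) :=
  fun F => ∀ X : S, m.M r X → ∀ φ : (Y S).obj X ⟶ F, φ = 0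

lemma Perp.mono {r s : ℕ} (h : r ≤ s) {F : ModCat S} (hF : m.Perp r F) : m.Perp s F :=
  fun X hX φ => hF X (mem_mono h hX) φ

/-- Sequential colimits of representables are cohomological. -/
lemma _root_.ExcellentMetric.ColimPres.exact (p : ColimPres c Z) {X₁ X₂ X₃ : S} {f : X₁ ⟶ X₂}
    {g : X₂ ⟶ X₃} {h : X₃ ⟶ X₁⟦(1 : ℤ)⟧} (hT : Triangle.mk f g h ∈ distTriang S)
    (φ : (Y S).obj X₂ ⟶ Z) (hφ : (Y S).map f ≫ φ = 0) :
    ∃ ψ : (Y S).obj X₃ ⟶ Z, φ = (Y S).map g ≫ ψ := by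
  obtain ⟨q, -, x, rfl⟩ := p.exists_lift φ 0
  rw [← Functor.map_comp_assoc] at hφ
  obtain ⟨q', hq, h₀⟩ := p.exists_comp_eq_zero hφ
  rw [Category.assoc] at h₀
  obtain ⟨y, hy⟩ : ∃ y : X₃ ⟶ c.obj q', x ≫ c.map (homOfLE hq) = g ≫ y :=
    Triangle.yoneda_exact₂ _ hT _ h₀
  refine ⟨(Y S).map y ≫ p.leg q', ?_⟩
  rw [← Functor.map_comp_assoc, ← hy, Functor.map_comp, Category.assoc, p.map_leg]

/-- Restriction along a morphism with cone in `M_r` is injective on maps to objects of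
`𝔏(S) ∩ Y(M_r)^⊥`. -/
lemma ConeMem.hom_injective {r : ℕ} {X X' : S} {x : X ⟶ X'} (hx : m.ConeMem r x) (hZ : m.Perp r Z)
    (p : ColimPres c Z) {φ ψ : (Y S).obj X' ⟶ Z} (h : (Y S).map x ≫ φ = (Y S).map x ≫ ψ) :
    φ = ψ := by
  obtain ⟨W, g, k, hT, hW⟩ := hx
  obtain ⟨χ, hχ⟩ := p.exact hT (φ - ψ) (by rw [Preadditive.comp_sub, h, sub_self])
  rw [hZ W hW χ, comp_zero, sub_eq_zero] at hχ
  exact hχ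

/-- Restriction along a morphism with cone in `M_{r+1}` is surjective on maps to objects of
`𝔏(S) ∩ Y(M_r)^⊥`. -/
lemma ConeMem.exists_extension {r : ℕ} {X X' : S} {x : X ⟶ X'} (hx : m.ConeMem (r + 1) x)
    (hZ : m.Perp r Z) (p : ColimPres c Z) (φ : (Y S).obj X ⟶ Z) :
    ∃ ψ : (Y S).obj X' ⟶ Z, (Y S).map x ≫ ψ = φ := by
  obtain ⟨W, g, k, hT, hW⟩ := hx
  obtain ⟨ψ, hψ⟩ := p.exact (inv_rot_of_distTriang _ hT) φ (hZ _ (m.shift_neg_mem r W hW) _)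
  exact ⟨ψ, hψ.symm⟩

/-- `N` bounds the Cauchy sequence `E` for `M_i`. -/
def CauchyBound (m : GoodMetric S) (E : ℕ ⥤ S) (i N : ℕ) : Prop :=
  ∀ (n n' : ℕ) (_ : N ≤ n) (h : n ≤ n'), m.ConeMem i (E.map (homOfLE h))

lemma exists_cauchyBound {E : ℕ ⥤ S} (hE : m.data.IsCauchy m.M E) (i : ℕ) :
    ∃ N, m.CauchyBound E i N :=
  coneMem_of_isCauchy hE i

lemma isCauchy_suspend {E : ℕ ⥤ S} (hE : m.data.IsCauchy m.M E) :
    m.data.IsCauchy m.M (E ⋙ m.data.shift.functor) :=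
  m.isCauchy_shift 1 m.shift_mem hE

lemma isCauchy_desuspend {E : ℕ ⥤ S} (hE : m.data.IsCauchy m.M E) :
    m.data.IsCauchy m.M (E ⋙ m.data.shift.inverse) :=
  m.isCauchy_shift (-1) m.shift_neg_mem hE

/-- A map from `colim Y(a_*)` to an object of `𝔏(S) ∩ Y(M_r)^⊥` is determined by its restriction
to a late enough `Y(a_n)`. -/
lemma hom_ext_of_leg (α : ColimPres a A) {r N n : ℕ} (hN : m.CauchyBound a r N) (hn : N ≤ n)
    (hZ : m.Perp r Z) (p : ColimPres c Z) {φ ψ : A ⟶ Z} (h : α.leg n ≫ φ = α.leg n ≫ ψ) :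
    φ = ψ := by
  have key : ∀ k, n ≤ k → α.leg k ≫ φ = α.leg k ≫ ψ := fun k hk => by
    refine (hN n k hn hk).hom_injective hZ p ?_
    rw [reassoc_of% α.map_leg hk, reassoc_of% α.map_leg hk, h]
  refine α.hom_ext fun k => ?_
  rw [← α.map_leg (le_max_left k n), Category.assoc, Category.assoc, key _ (le_max_right k n)]

/-- A map from a late enough `Y(a_n)` to an object of `𝔏(S) ∩ Y(M_r)^⊥` extends to
`colim Y(a_*)`. -/
lemma exists_extension_of_leg (α : ColimPres a A) {r N n : ℕ} (hN : m.CauchyBound a (r + 1) N)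
    (hn : N ≤ n) (hZ : m.Perp r Z) (p : ColimPres c Z) (φ : (Y S).obj (a.obj n) ⟶ Z) :
    ∃ ψ : A ⟶ Z, α.leg n ≫ ψ = φ := by
  choose ψ hψ using fun k : ℕ =>
    (hN n (n + k) hn (Nat.le_add_right n k)).exists_extension hZ p φ
  have hk : StrictMono (fun k : ℕ => n + k) := fun _ _ h => Nat.add_lt_add_left h n
  obtain ⟨χ, hχ⟩ := (α.subseq hk).exists_desc ψ fun k => by
    refine ((hN n (n + k) hn (Nat.le_add_right n k)).mono (Nat.le_succ r)).hom_injective hZ p ?_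
    have h := a.map_comp (homOfLE (Nat.le_add_right n k))
      (homOfLE (Nat.add_le_add_left (Nat.le_add_right k 1) n))
    rw [homOfLE_comp] at h
    refine Eq.trans ?_ (((hψ (k + 1)).trans (hψ k).symm))
    rw [h, Functor.map_comp, Category.assoc]
    rfl
  refine ⟨χ, ?_⟩
  rw [← α.map_leg (Nat.le_add_right n 0), Category.assoc]
  exact (congrArg _ (hχ 0)).trans (hψ 0)

variable (m) in
/-- `F : colim Y(a_*) ⟶ colim Y(b_*)` has type `k`: all late enough representatives `a_n ⟶ b_q` of
`F` have their cones in `M_k`. This depends on the presentations, but refers neither to a lift of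
`F` to a map of sequences nor to a completion of such a lift to triangles. -/
def HasType (k : ℕ) (α : ColimPres a A) (β : ColimPres b B) (F : A ⟶ B) : Prop :=
  ∃ N, ∀ (n q : ℕ) (_ : N ≤ n) (_ : N ≤ q) (x : a.obj n ⟶ b.obj q), Represents α β F x →
    m.ConeMem k x

lemma HasType.mono {k k' : ℕ} (h : k ≤ k') {α : ColimPres a A} {β : ColimPres b B} {F : A ⟶ B}
    (hF : m.HasType k' α β F) : m.HasType k α β F := by
  obtain ⟨N, hN⟩ := hF
  exact ⟨N, fun n q hn hq x hx => (hN n q hn hq x hx).mono h⟩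

/-- Restriction along a morphism of type `r` is injective on maps to objects of
`𝔏(S) ∩ Y(M_r)^⊥`. -/
lemma HasType.hom_injective (hb : m.data.IsCauchy m.M b) {r : ℕ} {α : ColimPres a A}
    {β : ColimPres b B} {F : A ⟶ B} (hF : m.HasType r α β F) (hZ : m.Perp r Z)
    (p : ColimPres c Z) {φ ψ : B ⟶ Z} (h : F ≫ φ = F ≫ ψ) : φ = ψ := by
  obtain ⟨N, hN⟩ := hF
  obtain ⟨N₁, h₁⟩ := exists_cauchyBound hb r
  obtain ⟨q, hq, x, hx⟩ := exists_represents α β F N (max N N₁)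
  refine hom_ext_of_leg β h₁ (le_of_max_le_right hq) hZ p ?_
  refine (hN N q le_rfl (le_of_max_le_left hq) x hx).hom_injective hZ p ?_
  rw [← reassoc_of% (show _ = _ from hx), ← reassoc_of% (show _ = _ from hx), h]

/-- Restriction along a morphism of type `r + 1` is surjective on maps to objects of
`𝔏(S) ∩ Y(M_r)^⊥`. -/
lemma HasType.exists_extension (ha : m.data.IsCauchy m.M a) (hb : m.data.IsCauchy m.M b) {r : ℕ}
    {α : ColimPres a A} {β : ColimPres b B} {F : A ⟶ B} (hF : m.HasType (r + 1) α β F)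
    (hZ : m.Perp r Z) (p : ColimPres c Z) (φ : A ⟶ Z) : ∃ ψ : B ⟶ Z, F ≫ ψ = φ := by
  obtain ⟨N, hN⟩ := hF
  obtain ⟨N₁, h₁⟩ := exists_cauchyBound hb (r + 1)
  obtain ⟨N₂, h₂⟩ := exists_cauchyBound ha r
  obtain ⟨q, hq, x, hx⟩ := exists_represents α β F (max N N₂) (max N N₁)
  obtain ⟨χ, hχ⟩ := (hN _ q (le_max_left _ _) (le_of_max_le_left hq) x hx).exists_extension hZ p
    (α.leg _ ≫ φ)
  obtain ⟨ψ, hψ⟩ := exists_extension_of_leg β h₁ (le_of_max_le_right hq) hZ p χ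
  refine ⟨ψ, hom_ext_of_leg α h₂ (le_max_right N N₂) hZ p ?_⟩
  rw [reassoc_of% (show _ = _ from hx), hψ, hχ]

variable [IsTriangulated S]

/-- One representative, taken beyond the Cauchy bounds, determines the type. -/
lemma hasType_of_represents {k N₁ N₂ : ℕ} (h₁ : m.CauchyBound a (k + 1) N₁)
    (h₂ : m.CauchyBound b (k + 1) N₂) {α : ColimPres a A} {β : ColimPres b B} {F : A ⟶ B}
    {n q : ℕ} (hn : N₁ ≤ n) (hq : N₂ ≤ q) {x : a.obj n ⟶ b.obj q} (hx : Represents α β F x)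
    (hxk : m.ConeMem k x) : m.HasType k α β F := by
  refine ⟨max n q, fun n' q' hn' hq' y hy => ?_⟩
  have hnn : n ≤ n' := le_of_max_le_left hn'
  have hqq : q ≤ q' := le_of_max_le_right hq'
  obtain ⟨q'', hq'', h⟩ := (hy.map_comp hnn).exists_eq (hx.comp_map hqq)
  rw [Category.assoc, Category.assoc, ← b.map_comp, homOfLE_comp] at h
  refine ConeMem.of_comp_right (h₂ q' q'' (hq.trans hqq) hq'') ?_
  refine ConeMem.of_comp_left (h₁ n n' hn hnn) ?_
  rw [h]
  exact hxk.comp ((h₂ q q'' hq (hqq.trans hq'')).mono (Nat.le_succ k))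

lemma hasType_id (ha : m.data.IsCauchy m.M a) (k : ℕ) (α : ColimPres a A) :
    m.HasType k α α (𝟙 A) := by
  obtain ⟨N, hN⟩ := exists_cauchyBound ha (k + 1)
  exact hasType_of_represents hN hN le_rfl le_rfl (x := 𝟙 _) (by simp [Represents]) (coneMem_id k _)

/-- If `F` and `F ≫ G` are of type `k + 1`, then `G` is of type `k`. -/
lemma HasType.of_comp_left (hb : m.data.IsCauchy m.M b) (hc : m.data.IsCauchy m.M c) {k : ℕ}
    {α : ColimPres a A} {β : ColimPres b B} {γ : ColimPres c Z} {F : A ⟶ B} {G : B ⟶ Z}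
    (hF : m.HasType (k + 1) α β F) (hFG : m.HasType (k + 1) α γ (F ≫ G)) : m.HasType k β γ G := by
  obtain ⟨N₁, h₁⟩ := hF
  obtain ⟨N₂, h₂⟩ := hFG
  obtain ⟨N₃, h₃⟩ := exists_cauchyBound hb (k + 1)
  obtain ⟨N₄, h₄⟩ := exists_cauchyBound hc (k + 1)
  obtain ⟨q, hq, x, hx⟩ := exists_represents α β F (max N₁ N₂) (max N₁ N₃)
  obtain ⟨l, hl, y, hy⟩ := exists_represents β γ G q (max N₂ N₄)
  exact hasType_of_represents h₃ h₄ (by omega) (by omega) hy (ConeMem.of_comp_left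
    (h₁ _ _ (by omega) (by omega) x hx)
    ((h₂ _ _ (by omega) (by omega) _ (hx.comp hy)).mono (Nat.le_succ k)))

lemma HasType.shift (ha : m.data.IsCauchy m.M a) (hb : m.data.IsCauchy m.M b) {k : ℕ}
    {α : ColimPres a A} {β : ColimPres b B} {F : A ⟶ B} (hF : m.HasType (k + 1) α β F) :
    m.HasType k (α.shift m.data) (β.shift m.data) (m.data.modShift.functor.map F) := by
  obtain ⟨N, hN⟩ := hF
  obtain ⟨N₁, h₁⟩ := exists_cauchyBound (isCauchy_suspend ha) (k + 1)
  obtain ⟨N₂, h₂⟩ := exists_cauchyBound (isCauchy_suspend hb) (k + 1)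
  obtain ⟨q, hq, x, hx⟩ := exists_represents α β F (max N N₁) (max N N₂)
  refine hasType_of_represents h₁ h₂ (le_max_right N N₁) (le_of_max_le_right hq) (hx.shift m.data)
    (hN _ _ (le_max_left _ _) (le_of_max_le_left hq) x hx).shift

end GoodMetric

section Sequences

variable {C : Type u} [Category.{v} C] [Preadditive C] {a b c : ℕ ⥤ C} {A B Z : ModCat C}

/-- A map of sequences induces a map of colimits. -/
lemma ColimPres.exists_map (α : ColimPres a A) (β : ColimPres b B) (f : a ⟶ b) :
    ∃ F : A ⟶ B, ∀ n, α.leg n ≫ F = (Y C).map (f.app n) ≫ β.leg n :=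
  α.exists_desc (fun n => (Y C).map (f.app n) ≫ β.leg n) fun n => by
    rw [← Functor.map_comp_assoc, f.naturality, Functor.map_comp, Category.assoc, β.map_leg]

/-- Every map between sequential colimits of representables comes from a map to a subsequence. -/
lemma ColimPres.exists_natTrans (α : ColimPres a A) (β : ColimPres b B) (F : A ⟶ B) :
    ∃ (k : ℕ → ℕ) (hk : StrictMono k) (f : a ⟶ hk.monotone.functor ⋙ b),
      ∀ n, Represents (n := n) (q := k n) α β F (f.app n) := by
  let T (n : ℕ) : Type v := {x : Σ q, (a.obj n ⟶ b.obj q) // Represents α β F x.2}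
  have next : ∀ (n : ℕ) (s : T n), ∃ (s' : T (n + 1)) (hq : s.1.1 < s'.1.1),
      a.map (homOfLE (Nat.le_add_right n 1)) ≫ s'.1.2 = s.1.2 ≫ b.map (homOfLE hq.le) := by
    rintro n ⟨⟨q, x⟩, hx⟩
    obtain ⟨q₁, hq₁, y, hy⟩ := exists_represents α β F (n + 1) (q + 1)
    obtain ⟨q₂, hq₂, h⟩ := (hy.map_comp (Nat.le_add_right n 1)).exists_eq
      (hx.comp_map ((Nat.le_succ q).trans hq₁))
    refine ⟨⟨⟨q₂, y ≫ b.map (homOfLE hq₂)⟩, hy.comp_map hq₂⟩, Nat.lt_of_lt_of_le hq₁ hq₂, ?_⟩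
    rw [Category.assoc, Category.assoc, ← b.map_comp, homOfLE_comp] at h
    exact h
  choose next hq hnext using next
  have init : ∃ _ : T 0, True := by
    obtain ⟨q, -, x, hx⟩ := exists_represents α β F 0 0
    exact ⟨⟨⟨q, x⟩, hx⟩, trivial⟩
  obtain ⟨s₀, -⟩ := init
  let s (n : ℕ) : T n := Nat.rec s₀ next n
  have hk : StrictMono fun n => (s n).1.1 := strictMono_nat_of_lt_succ fun n => hq n (s n)
  exact ⟨_, hk, NatTrans.ofSequence (fun n => (s n).1.2) fun n => hnext n (s n), fun n => (s n).2⟩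

end Sequences

namespace GoodMetric

variable {S : Type u} [Category.{v} S] [Preadditive S] [HasZeroObject S]
  [HasShift S ℤ] [∀ n : ℤ, (shiftFunctor S n).Additive] [Pretriangulated S]
  {m : GoodMetric S} {a b c : ℕ ⥤ S} {A B Z : ModCat S}

/-! ### Exactness of colimits of triangles -/

section Exact

variable {f : a ⟶ b} {g : b ⟶ c} {h : c ⟶ a ⋙ m.data.shift.functor} {α : ColimPres a A}
  {β : ColimPres b B} {γ : ColimPres c Z} {F : A ⟶ B} {G : B ⟶ Z}
  {H : Z ⟶ m.data.modShift.functor.obj A}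

lemma exact₂_of_colimit (hT : m.data.IsCauchyTriangles m.M f g h)
    (hc : m.data.IsColimitTriangle f g h α β γ F G H) {X : S} (φ : (Y S).obj X ⟶ B)
    (hφ : φ ≫ G = 0) : ∃ ψ : (Y S).obj X ⟶ A, φ = ψ ≫ F := by
  obtain ⟨q, -, x, rfl⟩ := β.exists_lift φ 0
  rw [Category.assoc, hc.comm₂, ← Functor.map_comp_assoc] at hφ
  obtain ⟨q', hq, h₀⟩ := γ.exists_comp_eq_zero hφ
  rw [Category.assoc, ← g.naturality, ← Category.assoc] at h₀
  obtain ⟨y, hy⟩ : ∃ y : X ⟶ a.obj q', x ≫ b.map (homOfLE hq) = y ≫ f.app q' :=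
    Triangle.coyoneda_exact₂ _ (hT.dist q') _ h₀
  refine ⟨(Y S).map y ≫ α.leg q', ?_⟩
  rw [Category.assoc, hc.comm₁, ← Functor.map_comp_assoc, ← hy, Functor.map_comp, Category.assoc,
    β.map_leg]

lemma exact₃_of_colimit (hT : m.data.IsCauchyTriangles m.M f g h)
    (hc : m.data.IsColimitTriangle f g h α β γ F G H) {X : S} (φ : (Y S).obj X ⟶ Z)
    (hφ : φ ≫ H = 0) : ∃ ψ : (Y S).obj X ⟶ B, φ = ψ ≫ G := by
  obtain ⟨q, -, x, rfl⟩ := γ.exists_lift φ 0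
  rw [Category.assoc, hc.comm₃, ← ColimPres.shift_leg, ← Functor.map_comp_assoc] at hφ
  obtain ⟨q', hq, h₀⟩ := (α.shift m.data).exists_comp_eq_zero hφ
  rw [Category.assoc, ← h.naturality, ← Category.assoc] at h₀
  obtain ⟨y, hy⟩ : ∃ y : X ⟶ b.obj q', x ≫ c.map (homOfLE hq) = y ≫ g.app q' :=
    Triangle.coyoneda_exact₃ _ (hT.dist q') _ h₀
  refine ⟨(Y S).map y ≫ β.leg q', ?_⟩
  rw [Category.assoc, hc.comm₂, ← Functor.map_comp_assoc, ← hy, Functor.map_comp, Category.assoc,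
    γ.map_leg]

lemma Perp.second (hT : m.data.IsCauchyTriangles m.M f g h)
    (hc : m.data.IsColimitTriangle f g h α β γ F G H) {r : ℕ} (hA : m.Perp r A)
    (hZ : m.Perp r Z) : m.Perp r B := fun X hX φ => by
  obtain ⟨ψ, rfl⟩ := exact₂_of_colimit hT hc φ (hZ X hX _)
  rw [hA X hX ψ, zero_comp]

lemma Perp.third (hT : m.data.IsCauchyTriangles m.M f g h)
    (hc : m.data.IsColimitTriangle f g h α β γ F G H) {r : ℕ} (hB : m.Perp r B)
    (hA : m.Perp r (m.data.modShift.functor.obj A)) : m.Perp r Z := fun X hX φ => by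
  obtain ⟨ψ, rfl⟩ := exact₃_of_colimit hT hc φ (hA X hX _)
  rw [hB X hX ψ, zero_comp]

end Exact

/-! ### Approximation of objects and of strong triangles -/

lemma HasType.subseq {k : ℕ} {α : ColimPres a A} {β : ColimPres b B} {F : A ⟶ B}
    (hF : m.HasType k α β F) {p : ℕ → ℕ} (hp : StrictMono p) :
    m.HasType k α (β.subseq hp) F := by
  obtain ⟨N, hN⟩ := hF
  exact ⟨N, fun n q hn hq x hx => hN n (p q) hn (hq.trans (hp.id_le q)) x hx⟩

/-- Every map between objects of `𝔏(S)` comes from a map of Cauchy sequences, after passing to a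
subsequence in the target. -/
lemma exists_natTrans_cauchy (hb : m.data.IsCauchy m.M b) (α : ColimPres a A) (β : ColimPres b B)
    (F : A ⟶ B) : ∃ (b₁ : ℕ ⥤ S) (β₁ : ColimPres b₁ B) (F' : a ⟶ b₁),
      m.data.IsCauchy m.M b₁ ∧ (∀ n, α.leg n ≫ F = (Y S).map (F'.app n) ≫ β₁.leg n) ∧
      ∀ {k : ℕ} {c : ℕ ⥤ S} {Z : ModCat S} (γ : ColimPres c Z) (G : Z ⟶ B),
        m.HasType k γ β G → m.HasType k γ β₁ G := by
  obtain ⟨p, hp, F', hF'⟩ := α.exists_natTrans β F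
  exact ⟨_, β.subseq hp, F', isCauchy_subseq hb hp, hF', fun _ _ h => h.subseq hp⟩

lemma isCauchy_const (X : S) : m.data.IsCauchy m.M ((Functor.const ℕ).obj X) :=
  fun i => ⟨0, fun _ _ _ _ => coneMem_id i X⟩

lemma perp_of_flBall {r : ℕ} (h : ∀ G : ModCat S, m.flBall r G → ∀ ψ : G ⟶ Z, ψ = 0) :
    m.Perp r Z := fun X hX φ =>
  h _ ⟨_, isCauchy_const X, fun _ => hX, ⟨ColimPres.const X⟩⟩ φ

variable [IsTriangulated S]

/-- Every object of `𝔏(S)` has a morphism of type `k` to an object of `𝔖(S)`. -/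
lemma exists_object_approx (hm : m.IsExcellent) (ha : m.data.IsCauchy m.M a) (α : ColimPres a A)
    (k : ℕ) : ∃ (d : ℕ ⥤ S) (D : ModCat S) (δ : ColimPres d D) (u : A ⟶ D),
      m.data.IsCauchy m.M d ∧ m.fs D ∧ m.HasType k α δ u := by
  -- the orthogonality level `r` does not depend on the object of `S` to be approximated, so that
  -- the term of `a_*` to be approximated can be chosen after it
  obtain ⟨r, -, hr⟩ := hm.coapprox k
  obtain ⟨N₁, h₁⟩ := exists_cauchyBound ha (r + 1)
  obtain ⟨N₂, h₂⟩ := exists_cauchyBound ha (k + 1)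
  obtain ⟨d, D, δ, φ, hd, ⟨p, q, hp, hq, f, hf, hft⟩, hD, hDr⟩ := hr (a.obj (max N₁ N₂))
  obtain ⟨u, hu⟩ := exists_extension_of_leg α h₁ (le_max_left N₁ N₂) (perp_of_flBall hDr) δ φ
  refine ⟨d, D, δ, u, hd, hD, ?_⟩
  obtain ⟨c, g, h, hT⟩ := exists_completion (isCauchy_subseq (isCauchy_const _) hp)
    (isCauchy_subseq hd hq) f
  obtain ⟨N₃, h₃⟩ := hft c g h hT
  obtain ⟨N₄, h₄⟩ := exists_cauchyBound hd (k + 1)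
  refine hasType_of_represents h₂ h₄ (le_max_right N₁ N₂)
    ((le_max_right N₃ N₄).trans (hq.id_le _)) (x := f.app (max N₃ N₄)) ?_
    ⟨_, _, _, hT.dist (max N₃ N₄), h₃ _ (le_max_left _ _)⟩
  refine Eq.trans (hu.trans ?_) (hf _)
  exact (Category.id_comp φ).symm

/-- If `a_* ⟶ b_* ⟶ c_*` is a Cauchy sequence of triangles with colimit `A ⟶ B ⟶ C`, every morphism
`B ⟶ B₁` of type `k` with `B₁ ∈ 𝔖(S)` extends to a morphism of strong triangles, of type `k` on
each term, whose target has its terms in `𝔖(S)`. -/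
lemma exists_triangle_approx (hm : m.IsExcellent) {f' : a ⟶ b} {g' : b ⟶ c}
    {h' : c ⟶ a ⋙ m.data.shift.functor} (hT : m.data.IsCauchyTriangles m.M f' g' h')
    {α : ColimPres a A} {β : ColimPres b B} {γ : ColimPres c Z} {f : A ⟶ B} {g : B ⟶ Z}
    {h : Z ⟶ m.data.modShift.functor.obj A}
    (hc : m.data.IsColimitTriangle f' g' h' α β γ f g h)
    {k : ℕ} {b₀ : ℕ ⥤ S} {B₁ : ModCat S} (hb₀ : m.data.IsCauchy m.M b₀) (β₀ : ColimPres b₀ B₁)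
    (hB₁ : m.fs B₁) (v : B ⟶ B₁) (hv : m.HasType k β β₀ v) :
    ∃ (a₁ c₁ : ℕ ⥤ S) (A₁ C₁ : ModCat S) (α₁ : ColimPres a₁ A₁) (γ₁ : ColimPres c₁ C₁)
      (u : A ⟶ A₁) (w : Z ⟶ C₁) (F : A₁ ⟶ B₁) (G : B₁ ⟶ C₁)
      (H : C₁ ⟶ m.data.modShift.functor.obj A₁),
      m.data.IsCauchy m.M a₁ ∧ m.data.IsCauchy m.M c₁ ∧ m.fs A₁ ∧ m.fs C₁ ∧
      m.HasType k α α₁ u ∧ m.HasType k γ γ₁ w ∧ m.data.IsStrongTriangle m.M F G H ∧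
      u ≫ F = f ≫ v ∧ v ≫ G = g ≫ w ∧ w ≫ H = h ≫ m.data.modShift.functor.map u := by
  obtain ⟨r, hr⟩ := hB₁.2
  obtain ⟨a₁, A₁, α₁, u, ha₁, hA₁, hu⟩ := exists_object_approx hm hT.cauchy₁ α (max (k + 1) (r + 1))
  obtain ⟨F, hF⟩ := (hu.mono (le_max_right _ _)).exists_extension hT.cauchy₁ ha₁ hr β₀ (f ≫ v)
  obtain ⟨b₁, β₁, F', hb₁, hF', ht⟩ := exists_natTrans_cauchy hb₀ α₁ β₀ F
  replace hv := ht β v hv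
  obtain ⟨c₁, G', H', hT₁⟩ := exists_completion ha₁ hb₁ F'
  obtain ⟨C₁, ⟨γ₁⟩⟩ := ColimPres.exists_colimPres c₁
  obtain ⟨G, hG⟩ := β₁.exists_map γ₁ G'
  obtain ⟨H, hH⟩ := γ₁.exists_map (α₁.shift m.data) H'
  have hc₁ : m.data.IsColimitTriangle F' G' H' α₁ β₁ γ₁ F G H := ⟨hF', hG, hH⟩
  have hsA₁ : m.fs (m.data.modShift.functor.obj A₁) := m.fs_shift _ hA₁
  obtain ⟨s, hs⟩ := hsA₁.2
  let t := max r s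
  have hpA : m.Perp t (m.data.modShift.functor.obj A₁) := Perp.mono (le_max_right r s) hs
  have hpB : m.Perp t B₁ := Perp.mono (le_max_left r s) hr
  have hpC : m.Perp t C₁ := Perp.third hT₁ hc₁ hpB hpA
  have hC₁ : m.fs C₁ := ⟨⟨c₁, hT₁.cauchy₃, ⟨γ₁⟩⟩, t, hpC⟩
  obtain ⟨N₁, h₁⟩ := hu
  obtain ⟨N₂, h₂⟩ := hv
  obtain ⟨N₃, h₃⟩ := exists_cauchyBound hT.cauchy₂ t
  obtain ⟨N₄, h₄⟩ := exists_cauchyBound hT.cauchy₃ (t + 1)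
  obtain ⟨N₅, h₅⟩ := exists_cauchyBound hT.cauchy₃ (k + 1)
  obtain ⟨N₆, h₆⟩ := exists_cauchyBound hT₁.cauchy₃ (k + 1)
  let n := max (max (max N₁ N₂) (max N₃ N₄)) N₅
  have hn : N₁ ≤ n ∧ N₂ ≤ n ∧ N₃ ≤ n ∧ N₄ ≤ n ∧ N₅ ≤ n := by omega
  -- one commutative square from `a_n ⟶ b_n` to a late term of `a₁_* ⟶ b₁_*`
  obtain ⟨l, hl, x, y, hx, hy, hxy⟩ : ∃ (l : ℕ) (_ : max (max N₁ N₂) N₆ ≤ l)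
      (x : a.obj n ⟶ a₁.obj l) (y : b.obj n ⟶ b₁.obj l), Represents α α₁ u x ∧
      Represents β β₁ v y ∧ f'.app n ≫ y = x ≫ F'.app l := by
    obtain ⟨l₁, hl₁, x, hx⟩ := exists_represents α α₁ u n (max (max N₁ N₂) N₆)
    obtain ⟨l₂, hl₂, y, hy⟩ := exists_represents β β₁ v n l₁
    have e : (Y S).map (f'.app n ≫ y) ≫ β₁.leg l₂ =
        (Y S).map (x ≫ a₁.map (homOfLE hl₂) ≫ F'.app l₂) ≫ β₁.leg l₂ := by
      rw [Functor.map_comp, Functor.map_comp, Functor.map_comp, Category.assoc, Category.assoc,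
        Category.assoc, ← hc₁.comm₁, reassoc_of% α₁.map_leg hl₂,
        ← reassoc_of% (show _ = _ from hx), hF, ← show _ = _ from hy,
        ← reassoc_of% hc.comm₁ n]
    obtain ⟨l₃, hl₃, h₀⟩ := β₁.exists_map_eq e
    refine ⟨l₃, hl₁.trans (hl₂.trans hl₃), x ≫ a₁.map (homOfLE (hl₂.trans hl₃)),
      y ≫ b₁.map (homOfLE hl₃), hx.comp_map _, hy.comp_map _, ?_⟩
    rw [Category.assoc, Category.assoc, Category.assoc] at h₀
    rw [h₀, Category.assoc, ← homOfLE_comp hl₂ hl₃, Functor.map_comp, Category.assoc,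
      F'.naturality]
  obtain ⟨z, hz₁, hz₂, hz₃⟩ := exists_good_fill (hT.dist n) (hT₁.dist l) x y hxy
  obtain ⟨w, hw⟩ := exists_extension_of_leg γ h₄ hn.2.2.2.1 hpC γ₁ ((Y S).map z ≫ γ₁.leg l)
  have hzk : m.ConeMem k z := by
    refine hz₃ m k ?_ ?_
    · exact (h₁ n l hn.1 (by omega) x hx).mono (le_max_left _ _)
    · exact h₂ n l hn.2.1 (by omega) y hy
  refine ⟨a₁, c₁, A₁, C₁, α₁, γ₁, u, w, F, G, H, ha₁, hT₁.cauchy₃, hA₁, hC₁, ?_, ?_,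
    ⟨_, _, _, _, _, _, _, _, _, hT₁, hc₁⟩, hF, ?_, ?_⟩
  · exact HasType.mono ((Nat.le_succ k).trans (le_max_left _ _)) ⟨N₁, h₁⟩
  · exact hasType_of_represents h₅ h₆ hn.2.2.2.2 (by omega) hw hzk
  · refine hom_ext_of_leg β h₃ hn.2.2.1 hpC γ₁ ?_
    rw [reassoc_of% hc.comm₂ n, hw, reassoc_of% (show _ = _ from hy), hc₁.comm₂,
      ← Functor.map_comp_assoc, ← Functor.map_comp_assoc]
    exact congrArg (fun t => (Y S).map t ≫ _) hz₁.symm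
  · refine hom_ext_of_leg γ (fun i j hi hij => (h₄ i j hi hij).mono (Nat.le_succ t)) hn.2.2.2.1
      hpA (α₁.shift m.data) ?_
    have e₁ := hx.shift m.data
    have e₂ := hc.comm₃ n
    have e₃ := hc₁.comm₃ l
    rw [← ColimPres.shift_leg] at e₂ e₃
    rw [reassoc_of% hw, e₃, reassoc_of% e₂, show _ = _ from e₁, ← Functor.map_comp_assoc,
      ← Functor.map_comp_assoc]
    exact congrArg (fun t => (Y S).map t ≫ _) hz₂.symm

end GoodMetric

/-! ### Eventually constant limits and colimits -/

/-- A cocone on a sequence whose structure morphisms are eventually isomorphisms is a colimit. -/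
noncomputable def isColimitOfEventuallyIso {C : Type u} [Category.{v} C] {E : ℕ ⥤ C}
    (c : Cocone E) {N : ℕ} (h : ∀ n, N ≤ n → IsIso (c.ι.app n)) : IsColimit c :=
  have := h N le_rfl
  { desc := fun s => inv (c.ι.app N) ≫ s.ι.app N
    fac := fun s n => by
      have := h (max n N) (le_max_right n N)
      have key : c.ι.app (max n N) ≫ inv (c.ι.app N) ≫ s.ι.app N = s.ι.app (max n N) := by
        have h₁ := c.w (homOfLE (le_max_right n N))
        have h₂ := s.w (homOfLE (le_max_right n N))
        have h₃ : IsIso (E.map (homOfLE (le_max_right n N))) := by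
          have : IsIso (E.map (homOfLE (le_max_right n N)) ≫ c.ι.app (max n N)) :=
            h₁.symm ▸ h N le_rfl
          exact IsIso.of_isIso_comp_right _ (c.ι.app (max n N))
        rw [← cancel_epi (E.map (homOfLE (le_max_right n N))), reassoc_of% h₁, h₂,
          IsIso.hom_inv_id_assoc]
      rw [← c.w (homOfLE (le_max_left n N)), Category.assoc, key, s.w]
    uniq := fun s f hf => by rw [← hf N, IsIso.inv_hom_id_assoc] }

/-- A cone on an inverse sequence whose projections are eventually isomorphisms is a limit. -/
noncomputable def isLimitOfEventuallyIso {C : Type u} [Category.{v} C] {E : ℕᵒᵖ ⥤ C}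
    (c : Cone E) {N : ℕ} (h : ∀ n, N ≤ n → IsIso (c.π.app (op n))) : IsLimit c :=
  have := h N le_rfl
  { lift := fun s => s.π.app (op N) ≫ inv (c.π.app (op N))
    fac := fun s n => by
      induction n with | op n =>
      have := h (max n N) (le_max_right n N)
      have key : (s.π.app (op N) ≫ inv (c.π.app (op N))) ≫ c.π.app (op (max n N)) =
          s.π.app (op (max n N)) := by
        have h₁ := c.w (homOfLE (le_max_right n N)).op
        have h₂ := s.w (homOfLE (le_max_right n N)).op
        have h₃ : IsIso (E.map (homOfLE (le_max_right n N)).op) := by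
          have : IsIso (c.π.app (op (max n N)) ≫ E.map (homOfLE (le_max_right n N)).op) :=
            h₁.symm ▸ h N le_rfl
          exact IsIso.of_isIso_comp_left (c.π.app (op (max n N))) _
        rw [← cancel_mono (E.map (homOfLE (le_max_right n N)).op), Category.assoc, h₁, h₂,
          Category.assoc, IsIso.inv_hom_id, Category.comp_id]
      rw [← c.w (homOfLE (le_max_left n N)).op, ← Category.assoc, key, s.w]
    uniq := fun s f hf => by rw [← hf (op N), Category.assoc, IsIso.hom_inv_id, Category.comp_id] }

namespace GoodMetric

variable {S : Type u} [Category.{v} S] [Preadditive S] [HasZeroObject S]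
  [HasShift S ℤ] [∀ n : ℤ, (shiftFunctor S n).Additive] [Pretriangulated S]
  {m : GoodMetric S} {a b c : ℕ ⥤ S} {A B Z : ModCat S}

/-! ### Evaluation of morphisms of high type -/

/-- If `Hom(X, M_i) = 0`, morphisms of type `i + 1` are bijective on sections over `X`. -/
lemma HasType.bijective_app {X : S} {i : ℕ} (hX : ∀ W : S, m.M i W → ∀ φ : X ⟶ W, φ = 0)
    {α : ColimPres a A} {β : ColimPres b B} {F : A ⟶ B} (hF : m.HasType (i + 1) α β F) :
    Function.Bijective (F.app (op X)) := by
  obtain ⟨N, hN⟩ := hF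
  constructor
  · rw [injective_iff_map_eq_zero]
    intro e he
    obtain ⟨n₀, x₀, rfl⟩ := α.exists_section e
    have h₀ : ((Y S).map x₀ ≫ α.leg n₀) ≫ F = 0 := yoneda_hom_ext he
    obtain ⟨n, hn, x, hx⟩ := α.exists_lift ((Y S).map x₀ ≫ α.leg n₀) N
    obtain ⟨q, hq, y, hy⟩ := exists_represents α β F n N
    rw [hx, Category.assoc, show _ = _ from hy, ← Functor.map_comp_assoc] at h₀
    obtain ⟨q', hq', h₁⟩ := β.exists_comp_eq_zero h₀
    rw [Category.assoc] at h₁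
    obtain ⟨W, g, k, hT, hW⟩ := hN n q' hn (hq.trans hq') _ (hy.comp_map hq')
    obtain ⟨z, hz⟩ := Triangle.coyoneda_exact₂ _ (inv_rot_of_distTriang _ hT) x h₁
    have hx₀ : x = 0 :=
      hz.trans ((congrArg (· ≫ _) (hX _ (m.shift_neg_mem i W hW) z)).trans zero_comp)
    rw [hx, hx₀, Functor.map_zero, zero_comp]
    rfl
  · intro e
    obtain ⟨q, x, rfl⟩ := β.exists_section e
    obtain ⟨q', hq', y, hy⟩ := exists_represents α β F N (max q N)
    obtain ⟨W, g, k, hT, hW⟩ := hN N q' le_rfl (le_of_max_le_right hq') y hy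
    obtain ⟨z, hz⟩ : ∃ z : X ⟶ a.obj N, x ≫ b.map (homOfLE (le_of_max_le_left hq')) = z ≫ y :=
      Triangle.coyoneda_exact₂ _ hT _
        ((Category.assoc _ _ _).trans (hX W (m.mem_of_succ i W hW) _))
    refine ⟨((Y S).map z ≫ α.leg N).app (op X) (𝟙 X), ?_⟩
    have h : ((Y S).map z ≫ α.leg N) ≫ F = (Y S).map x ≫ β.leg q := by
      rw [Category.assoc, show _ = _ from hy, ← Functor.map_comp_assoc, ← hz, Functor.map_comp,
        Category.assoc, β.map_leg]
    rw [← h]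
    rfl

/-! ### Fibers in `𝔖(S)` -/

variable [IsTriangulated S]

/-- A morphism `F : A ⟶ B` of type `i + 1` in `𝔖(S)` has a fiber in `𝔑_i`: there is a strong
triangle `Σ⁻¹B ⟶ Z ⟶ A ⟶ ΣΣ⁻¹B ≅ B`. On the level of sequences it is the double inverse rotation of
a completion of `a_* ⟶ b_*`. -/
lemma HasType.exists_fiber (ha : m.data.IsCauchy m.M a) (hb : m.data.IsCauchy m.M b) {i : ℕ}
    {α : ColimPres a A} {β : ColimPres b B} {F : A ⟶ B} (hF : m.HasType (i + 1) α β F)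
    (hA : m.fs A) (hB : m.fs B) :
    ∃ (Z : ModCat S) (V : m.data.modShift.inverse.obj B ⟶ Z) (W : Z ⟶ A), m.fs Z ∧ m.flBall i Z ∧
      m.data.IsStrongTriangle m.M V W (F ≫ m.data.modShift.counitIso.inv.app B) := by
  obtain ⟨b₁, β₁, F', hb₁, hF', ht⟩ := exists_natTrans_cauchy hb α β F
  obtain ⟨N, hN⟩ := ht α F hF
  obtain ⟨c, G, H, hT⟩ := exists_completion ha hb₁ F'
  let T : ℕ ⥤ Triangle S := Triangle.functorMk F' G H ⋙ invRotate S ⋙ invRotate S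
  have hTd : ∀ n, T.obj n ∈ distTriang S := fun n =>
    inv_rot_of_distTriang _ (inv_rot_of_distTriang _ (hT.dist n))
  have hTc : m.data.IsCauchyTriangles m.M (a := b₁ ⋙ m.data.shift.inverse)
      (b := c ⋙ m.data.shift.inverse) (c := a) (Functor.whiskerLeft T Triangle.π₁Toπ₂)
      (Functor.whiskerLeft T Triangle.π₂Toπ₃) (Functor.whiskerLeft T Triangle.π₃Toπ₁) :=
    ⟨isCauchy_desuspend hb₁, isCauchy_desuspend hT.cauchy₃, ha, hTd⟩
  obtain ⟨Z, ⟨ζ⟩⟩ := ColimPres.exists_colimPres (c ⋙ m.data.shift.inverse)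
  obtain ⟨V, hV⟩ := (β₁.desuspend m.data).exists_map ζ (Functor.whiskerLeft T Triangle.π₁Toπ₂)
  obtain ⟨W, hW⟩ := ζ.exists_map α (Functor.whiskerLeft T Triangle.π₂Toπ₃)
  have hcol : m.data.IsColimitTriangle (a := b₁ ⋙ m.data.shift.inverse)
      (b := c ⋙ m.data.shift.inverse) (c := a) (Functor.whiskerLeft T Triangle.π₁Toπ₂)
      (Functor.whiskerLeft T Triangle.π₂Toπ₃) (Functor.whiskerLeft T Triangle.π₃Toπ₁)
      (β₁.desuspend m.data) ζ α V W (F ≫ m.data.modShift.counitIso.inv.app B) := by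
    refine ⟨hV, hW, fun n => ?_⟩
    have e := ColimPres.yonedaShift_desuspend_leg m.data β₁ n
    rw [reassoc_of% hF' n]
    refine (congrArg ((Y S).map (F'.app n) ≫ ·) e.symm).trans ?_
    refine (Category.assoc _ _ _).symm.trans ?_
    exact congrArg (· ≫ _) ((Y S).map_comp _ _).symm
  obtain ⟨r, hr⟩ := (m.fs_shift_inv B hB).2
  obtain ⟨s, hs⟩ := hA.2
  have hZ : m.Perp (max r s) Z :=
    Perp.second hTc hcol (Perp.mono (le_max_left r s) hr) (Perp.mono (le_max_right r s) hs)
  have hk : StrictMono fun n : ℕ => N + n := fun _ _ h => Nat.add_lt_add_left h N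
  refine ⟨Z, V, W, ⟨⟨_, hTc.cauchy₂, ⟨ζ⟩⟩, _, hZ⟩,
    ⟨_, isCauchy_subseq hTc.cauchy₂ hk, fun n => ?_, ⟨ζ.subseq hk⟩⟩,
    ⟨_, _, _, _, _, _, _, _, _, hTc, hcol⟩⟩
  exact m.shift_neg_mem i _ ((hN (N + n) (N + n) (Nat.le_add_right N n) (Nat.le_add_right N n) _
    (hF' (N + n))).mem (hT.dist (N + n)))

end GoodMetric

namespace GoodMetric

variable {S : Type u} [Category.{v} S] [Preadditive S] [HasZeroObject S]
  [HasShift S ℤ] [∀ n : ℤ, (shiftFunctor S n).Additive] [Pretriangulated S]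
  {m : GoodMetric S} {a b c : ℕ ⥤ S} {A B Z : ModCat S}

/-! ### Towers of approximations of an object -/

variable (m) in
/-- A morphism from `A` to an object of `𝔖(S)`, presented by a Cauchy sequence. -/
structure Approx (A : ModCat S) where
  obj : ModCat S
  seq : ℕ ⥤ S
  pres : ColimPres seq obj
  map : A ⟶ obj
  cauchy : m.data.IsCauchy m.M seq
  fs : m.fs obj

/-- The suspension of an approximation. -/
noncomputable def Approx.suspend (X : m.Approx A) : m.Approx (m.data.modShift.functor.obj A) where
  obj := m.data.modShift.functor.obj X.obj
  seq := X.seq ⋙ m.data.shift.functor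
  pres := X.pres.shift m.data
  map := m.data.modShift.functor.map X.map
  cauchy := isCauchy_suspend X.cauchy
  fs := m.fs_shift _ X.fs

/-- The morphism from the representable `Hom_𝔖(X, -)` to `Ŷ(A)` given by a morphism `A ⟶ X`. -/
def yhatLeg {X : m.FS} (u : A ⟶ X.obj) : (Y m.FSᵒᵖ).obj (op X) ⟶ m.yhat.obj (op A) where
  app W := AddCommGrpCat.ofHom (X := W.unop ⟶ op X) (Y := A ⟶ W.unop.unop.obj)
    (AddMonoidHom.mk' (fun t => u ≫ t.unop.hom) fun s t => Preadditive.comp_add _ _ _ u _ _)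
  naturality W W' f := by
    ext (t : W.unop ⟶ op X)
    exact (Category.assoc u t.unop.hom f.unop.unop.hom).symm

lemma map_yhatLeg {X X' : m.FS} (u : A ⟶ X'.obj) (t : X' ⟶ X) :
    (Y m.FSᵒᵖ).map t.op ≫ yhatLeg u = yhatLeg (u ≫ t.hom) := by
  ext W (s : W.unop ⟶ op X)
  exact (Category.assoc u t.hom s.unop.hom).symm

lemma bijective_yhatLeg {X : m.FS} (u : A ⟶ X.obj) (W : m.FSᵒᵖᵒᵖ)
    (h₁ : ∀ s t : X.obj ⟶ W.unop.unop.obj, u ≫ s = u ≫ t → s = t)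
    (h₂ : ∀ t : A ⟶ W.unop.unop.obj, ∃ s : X.obj ⟶ W.unop.unop.obj, u ≫ s = t) :
    Function.Bijective ((yhatLeg u).app W) := by
  constructor
  · intro (s : W.unop ⟶ op X) (t : W.unop ⟶ op X) h
    exact Quiver.Hom.unop_inj (ObjectProperty.hom_ext _ (h₁ _ _ h))
  · intro (t : A ⟶ W.unop.unop.obj)
    obtain ⟨s, hs⟩ := h₂ t
    let s' : X ⟶ W.unop.unop := ObjectProperty.homMk s
    exact ⟨s'.op, hs⟩

variable (m) in
/-- A sequence of approximations of `A = colim Y(a_*)`, whose types tend to infinity, with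
compatible transition morphisms. -/
structure Tower (α : ColimPres a A) where
  X : ℕ → m.Approx A
  trans : ∀ n, (X (n + 1)).obj ⟶ (X n).obj
  comm : ∀ n, (X (n + 1)).map ≫ trans n = (X n).map
  type : ∀ k, ∃ N, ∀ n, N ≤ n → m.HasType k α (X n).pres (X n).map

namespace Tower

variable {α : ColimPres a A} (T : m.Tower α)

/-- The inverse sequence in `𝔖(S)` underlying a tower. -/
noncomputable abbrev invSeq : ℕᵒᵖ ⥤ m.FS :=
  Functor.ofOpSequence (X := fun n => ⟨(T.X n).obj, (T.X n).fs⟩)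
    fun n => ObjectProperty.homMk (T.trans n)

/-- The cone over the inverse sequence of a tower with vertex the approximated object. -/
noncomputable def cone : (Functor.const ℕᵒᵖ).obj A ⟶ T.invSeq ⋙ m.fs.ι :=
  NatTrans.ofOpSequence (fun n => (T.X n).map) fun n => by
    have h : (T.invSeq.map (homOfLE (n.le_add_right 1)).op).hom = T.trans n :=
      congrArg InducedCategory.Hom.hom (Functor.ofOpSequence_map_homOfLE_succ _ n)
    refine (Category.id_comp _).trans ((T.comm n).symm.trans ?_)
    exact congrArg ((T.X (n + 1)).map ≫ ·) h.symm

lemma map_comp_invSeq {n n' : ℕ} (h : n ≤ n') :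
    (T.X n').map ≫ (T.invSeq.map (homOfLE h).op).hom = (T.X n).map :=
  (T.cone.naturality (homOfLE h).op).symm.trans (Category.id_comp _)

/-- The limit of a tower is the approximated object, if every object of `S` is left orthogonal to
some `M_i`: over each object of `S` the tower is eventually constant. -/
noncomputable def limPres (hS : ∀ X : S, ∃ i : ℕ, ∀ Z : S, m.M i Z → ∀ φ : X ⟶ Z, φ = 0) :
    m.LimPres T.invSeq A where
  π := T.cone
  isLimit := evaluationJointlyReflectsLimits _ fun W =>
    have h : ∃ N, ∀ n, N ≤ n → IsIso ((T.X n).map.app W) := by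
      obtain ⟨i, hi⟩ := hS W.unop
      obtain ⟨N, hN⟩ := T.type (i + 1)
      exact ⟨N, fun n hn => (ConcreteCategory.isIso_iff_bijective _).2 ((hN n hn).bijective_app hi)⟩
    isLimitOfEventuallyIso _ (N := h.choose) h.choose_spec

/-- `Ŷ` takes a tower to a colimit: against each object of `𝔖(S)` the tower is eventually
constant. -/
noncomputable def yhatPres (ha : m.data.IsCauchy m.M a) :
    ColimPres T.invSeq.rightOp (m.yhat.obj (op A)) where
  ι := NatTrans.ofSequence (F := T.invSeq.rightOp ⋙ Y m.FSᵒᵖ)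
    (G := (Functor.const ℕ).obj (m.yhat.obj (op A)))
    (fun n => yhatLeg (X := T.invSeq.obj (op n)) (T.X n).map) fun n => by
      refine (map_yhatLeg _ _).trans (Eq.trans ?_ (Category.comp_id _).symm)
      exact congrArg yhatLeg (T.map_comp_invSeq (Nat.le_add_right n 1))
  isColimit := evaluationJointlyReflectsColimits _ fun W =>
    have h : ∃ N, ∀ n, N ≤ n →
        IsIso ((yhatLeg (X := T.invSeq.obj (op n)) (T.X n).map).app W) := by
      obtain ⟨⟨s, -, ⟨p⟩⟩, r, hr⟩ := W.unop.unop.property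
      obtain ⟨N, hN⟩ := T.type (r + 1)
      exact ⟨N, fun n hn => (ConcreteCategory.isIso_iff_bijective _).2
        (bijective_yhatLeg _ _
          (fun _ _ => ((hN n hn).mono (Nat.le_succ r)).hom_injective (T.X n).cauchy hr p)
          ((hN n hn).exists_extension ha (T.X n).cauchy hr p))⟩
    isColimitOfEventuallyIso _ (N := h.choose) h.choose_spec

variable [IsTriangulated S]

/-- A tower is a Cauchy sequence in `𝔖(S)^op`: its transition morphisms have high type, so their
fibers lie in small balls. -/
lemma isInverseCauchy : m.IsInverseCauchy T.invSeq := by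
  intro i
  obtain ⟨N, hN⟩ := T.type (i + 2)
  refine ⟨N, fun n n' hn h => ?_⟩
  have ht : m.HasType (i + 1) (T.X n').pres (T.X n).pres (T.invSeq.map (homOfLE h.le).op).hom := by
    refine HasType.of_comp_left (T.X n').cauchy (T.X n).cauchy (hN n' (hn.trans h.le)) ?_
    have := hN n hn
    rwa [← T.map_comp_invSeq h.le] at this
  obtain ⟨Z, V, W, hZ, hZi, hT⟩ :=
    ht.exists_fiber (T.X n').cauchy (T.X n).cauchy (T.X n').fs (T.X n).fs
  let Z' : m.FS := ⟨Z, hZ⟩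
  let W' : Z' ⟶ T.invSeq.obj (op n') := ObjectProperty.homMk W
  let V' : m.fsData.shift.inverse.obj (T.invSeq.obj (op n)) ⟶ Z' := ObjectProperty.homMk V
  exact ⟨op Z', W'.op, V'.op, hT, hZi⟩

end Tower

end GoodMetric

namespace GoodMetric

variable {S : Type u} [Category.{v} S] [Preadditive S] [HasZeroObject S]
  [HasShift S ℤ] [∀ n : ℤ, (shiftFunctor S n).Additive] [Pretriangulated S]
  {m : GoodMetric S} {a b c : ℕ ⥤ S} {A B Z : ModCat S}

/-! ### Towers of approximations of a strong triangle -/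

variable (m) in
/-- A morphism from the triangle `A ⟶ B ⟶ Z ⟶ ΣA` to a distinguished triangle of `𝔖(S)`. If `B` is
in `𝔖(S)`, the component at `B` is required to be the identity. -/
structure TriangleApprox (f : A ⟶ B) (g : B ⟶ Z) (h : Z ⟶ m.data.modShift.functor.obj A) where
  X₁ : m.Approx A
  X₂ : m.Approx B
  X₃ : m.Approx Z
  F : X₁.obj ⟶ X₂.obj
  G : X₂.obj ⟶ X₃.obj
  H : X₃.obj ⟶ m.data.modShift.functor.obj X₁.obj
  strong : m.data.IsStrongTriangle m.M F G H
  comm₁ : X₁.map ≫ F = f ≫ X₂.map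
  comm₂ : X₂.map ≫ G = g ≫ X₃.map
  comm₃ : X₃.map ≫ H = h ≫ m.data.modShift.functor.map X₁.map
  const : m.fs B → ∃ e : X₂.obj = B, X₂.map = eqToHom e.symm

section

variable {f : A ⟶ B} {g : B ⟶ Z} {h : Z ⟶ m.data.modShift.functor.obj A}

/-- All components of the approximation are of type `k`. -/
structure TriangleApprox.HasType (T : m.TriangleApprox f g h) (k : ℕ) (α : ColimPres a A)
    (β : ColimPres b B) (γ : ColimPres c Z) : Prop where
  type₁ : m.HasType k α T.X₁.pres T.X₁.map
  type₂ : m.HasType k β T.X₂.pres T.X₂.map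
  type₃ : m.HasType k γ T.X₃.pres T.X₃.map

variable (m) in
/-- A sequence of approximations of the triangle `A ⟶ B ⟶ Z ⟶ ΣA`, whose types tend to infinity,
with compatible transition morphisms. -/
structure TriangleTower (α : ColimPres a A) (β : ColimPres b B) (γ : ColimPres c Z) (f : A ⟶ B)
    (g : B ⟶ Z) (h : Z ⟶ m.data.modShift.functor.obj A) where
  T : ℕ → m.TriangleApprox f g h
  type : ∀ n, (T n).HasType n α β γ
  trans₁ : ∀ n, (T (n + 1)).X₁.obj ⟶ (T n).X₁.obj
  trans₂ : ∀ n, (T (n + 1)).X₂.obj ⟶ (T n).X₂.obj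
  trans₃ : ∀ n, (T (n + 1)).X₃.obj ⟶ (T n).X₃.obj
  map_trans₁ : ∀ n, (T (n + 1)).X₁.map ≫ trans₁ n = (T n).X₁.map
  map_trans₂ : ∀ n, (T (n + 1)).X₂.map ≫ trans₂ n = (T n).X₂.map
  map_trans₃ : ∀ n, (T (n + 1)).X₃.map ≫ trans₃ n = (T n).X₃.map
  comm₁ : ∀ n, trans₁ n ≫ (T n).F = (T (n + 1)).F ≫ trans₂ n
  comm₂ : ∀ n, trans₂ n ≫ (T n).G = (T (n + 1)).G ≫ trans₃ n
  comm₃ : ∀ n, trans₃ n ≫ (T n).H = (T (n + 1)).H ≫ m.data.modShift.functor.map (trans₁ n)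

/-- The first term of a strong triangle may be changed along an isomorphism. -/
lemma isStrongTriangle_of_iso {A' : ModCat S} (hs : m.data.IsStrongTriangle m.M f g h)
    (e : A ≅ A') :
    m.data.IsStrongTriangle m.M (e.inv ≫ f) g (h ≫ m.data.modShift.functor.map e.hom) := by
  obtain ⟨a, b, c, f', g', h', α, β, γ, hT, hc⟩ := hs
  refine ⟨a, b, c, f', g', h', α.ofIso e, β, γ, hT, fun n => ?_, hc.comm₂, fun n => ?_⟩
  · rw [ColimPres.ofIso_leg, Category.assoc, e.hom_inv_id_assoc, hc.comm₁]
  · rw [ColimPres.ofIso_leg, reassoc_of% hc.comm₃ n, Functor.map_comp]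

lemma yhatLeg_map {X : m.FS} (u : B ⟶ X.obj) (f : A ⟶ B) :
    yhatLeg u ≫ m.yhat.map f.op = yhatLeg (f ≫ u) := by
  ext W (s : W.unop ⟶ op X)
  exact (Category.assoc f u s.unop.hom).symm

namespace TriangleTower

variable {α : ColimPres a A} {β : ColimPres b B} {γ : ColimPres c Z}
  (T : m.TriangleTower α β γ f g h)

/-- The tower of first terms. -/
def tower₁ : m.Tower α where
  X n := (T.T n).X₁
  trans := T.trans₁
  comm := T.map_trans₁
  type k := ⟨k, fun n hn => (T.type n).type₁.mono hn⟩

/-- The tower of second terms. -/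
def tower₂ : m.Tower β where
  X n := (T.T n).X₂
  trans := T.trans₂
  comm := T.map_trans₂
  type k := ⟨k, fun n hn => (T.type n).type₂.mono hn⟩

/-- The tower of third terms. -/
def tower₃ : m.Tower γ where
  X n := (T.T n).X₃
  trans := T.trans₃
  comm := T.map_trans₃
  type k := ⟨k, fun n hn => (T.type n).type₃.mono hn⟩

end TriangleTower

end

/-- A morphism of type `l` from a sequence with terms eventually in `M_l` has its target in
`𝔏_l`. -/
lemma HasType.flBall {l : ℕ} {α : ColimPres a A} {β : ColimPres b B} {F : A ⟶ B}
    (hF : m.HasType l α β F) (hb : m.data.IsCauchy m.M b) (ha : ∃ N, ∀ n, N ≤ n → m.M l (a.obj n)) :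
    m.flBall l B := by
  obtain ⟨N, hN⟩ := hF
  obtain ⟨N₁, h₁⟩ := ha
  obtain ⟨q, hq, x, hx⟩ := exists_represents α β F (max N N₁) N
  have hk : StrictMono fun n : ℕ => q + n := fun _ _ h => Nat.add_lt_add_left h q
  refine ⟨_, isCauchy_subseq hb hk, fun n => ?_, ⟨β.subseq hk⟩⟩
  exact (hN _ (q + n) (le_max_left _ _) (hq.trans (Nat.le_add_right q n)) _
    (hx.comp_map (Nat.le_add_right q n))).mem_target (h₁ _ (le_max_right _ _))

variable [IsTriangulated S]

/-- The suspension of a tower. -/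
noncomputable def Tower.suspend {α : ColimPres a A} (T : m.Tower α) (ha : m.data.IsCauchy m.M a) :
    m.Tower (α.shift m.data) where
  X n := (T.X n).suspend
  trans n := m.data.modShift.functor.map (T.trans n)
  comm n := ((m.data.modShift.functor.map_comp _ _).symm).trans (congrArg _ (T.comm n))
  type k := by
    obtain ⟨N, hN⟩ := T.type (k + 1)
    exact ⟨N, fun n hn => (hN n hn).shift ha (T.X n).cauchy⟩

section

variable {f : A ⟶ B} {g : B ⟶ Z} {h : Z ⟶ m.data.modShift.functor.obj A}
  {f' : a ⟶ b} {g' : b ⟶ c} {h' : c ⟶ a ⋙ m.data.shift.functor} {α : ColimPres a A}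
  {β : ColimPres b B} {γ : ColimPres c Z}

lemma exists_triangleApprox (hm : m.IsExcellent) (hT : m.data.IsCauchyTriangles m.M f' g' h')
    (hc : m.data.IsColimitTriangle f' g' h' α β γ f g h) (k : ℕ) :
    ∃ T : m.TriangleApprox f g h, T.HasType k α β γ := by
  obtain ⟨X₂, h₂, hX₂⟩ : ∃ X : m.Approx B, m.HasType k β X.pres X.map ∧
      (m.fs B → ∃ e : X.obj = B, X.map = eqToHom e.symm) := by
    by_cases hB : m.fs B
    · exact ⟨⟨B, b, β, 𝟙 B, hT.cauchy₂, hB⟩, hasType_id hT.cauchy₂ k β, fun _ => ⟨rfl, rfl⟩⟩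
    · obtain ⟨d, D, δ, u, hd, hD, hu⟩ := exists_object_approx hm hT.cauchy₂ β k
      exact ⟨⟨D, d, δ, u, hd, hD⟩, hu, fun h => (hB h).elim⟩
  obtain ⟨a₁, c₁, A₁, C₁, α₁, γ₁, u, w, F, G, H, ha₁, hc₁, hA₁, hC₁, h₁, h₃, hs, e₁, e₂, e₃⟩ :=
    exists_triangle_approx hm hT hc X₂.cauchy X₂.pres X₂.fs X₂.map h₂
  exact ⟨⟨⟨A₁, a₁, α₁, u, ha₁, hA₁⟩, X₂, ⟨C₁, c₁, γ₁, w, hc₁, hC₁⟩, F, G, H, hs, e₁, e₂, e₃, hX₂⟩,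
    h₁, h₂, h₃⟩

/-- Every approximation factors through one of arbitrarily high type. All the relations between the
factorizations hold because they hold after restriction to the approximated triangle. -/
lemma TriangleApprox.exists_next (hm : m.IsExcellent)
    (hT : m.data.IsCauchyTriangles m.M f' g' h')
    (hc : m.data.IsColimitTriangle f' g' h' α β γ f g h) (T : m.TriangleApprox f g h) (k : ℕ) :
    ∃ T' : m.TriangleApprox f g h, T'.HasType k α β γ ∧
      ∃ (t₁ : T'.X₁.obj ⟶ T.X₁.obj) (t₂ : T'.X₂.obj ⟶ T.X₂.obj) (t₃ : T'.X₃.obj ⟶ T.X₃.obj),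
        T'.X₁.map ≫ t₁ = T.X₁.map ∧ T'.X₂.map ≫ t₂ = T.X₂.map ∧ T'.X₃.map ≫ t₃ = T.X₃.map ∧
        t₁ ≫ T.F = T'.F ≫ t₂ ∧ t₂ ≫ T.G = T'.G ≫ t₃ ∧
        t₃ ≫ T.H = T'.H ≫ m.data.modShift.functor.map t₁ := by
  obtain ⟨r₁, h₁⟩ := T.X₁.fs.2
  obtain ⟨r₂, h₂⟩ := T.X₂.fs.2
  obtain ⟨r₃, h₃⟩ := T.X₃.fs.2
  obtain ⟨r₄, h₄⟩ := T.X₁.suspend.fs.2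
  obtain ⟨r, hr⟩ : ∃ r, r = max (max r₁ r₂) (max r₃ r₄) := ⟨_, rfl⟩
  replace h₁ : m.Perp r _ := Perp.mono (by omega) h₁
  replace h₂ : m.Perp r _ := Perp.mono (by omega) h₂
  replace h₃ : m.Perp r _ := Perp.mono (by omega) h₃
  replace h₄ : m.Perp r (m.data.modShift.functor.obj T.X₁.obj) := Perp.mono (by omega) h₄
  obtain ⟨T', hT'⟩ := exists_triangleApprox hm hT hc (max k (r + 1))
  have d₁ := hT'.type₁.mono (le_max_right _ _)
  have d₂ := hT'.type₂.mono (le_max_right _ _)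
  have d₃ := hT'.type₃.mono (le_max_right _ _)
  obtain ⟨t₁, e₁⟩ := d₁.exists_extension hT.cauchy₁ T'.X₁.cauchy h₁ T.X₁.pres T.X₁.map
  obtain ⟨t₂, e₂⟩ := d₂.exists_extension hT.cauchy₂ T'.X₂.cauchy h₂ T.X₂.pres T.X₂.map
  obtain ⟨t₃, e₃⟩ := d₃.exists_extension hT.cauchy₃ T'.X₃.cauchy h₃ T.X₃.pres T.X₃.map
  refine ⟨T', ⟨hT'.type₁.mono (le_max_left _ _), hT'.type₂.mono (le_max_left _ _),
    hT'.type₃.mono (le_max_left _ _)⟩, t₁, t₂, t₃, e₁, e₂, e₃, ?_, ?_, ?_⟩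
  · refine (d₁.mono (Nat.le_succ r)).hom_injective T'.X₁.cauchy h₂ T.X₂.pres ?_
    rw [reassoc_of% e₁, reassoc_of% T'.comm₁, e₂, T.comm₁]
  · refine (d₂.mono (Nat.le_succ r)).hom_injective T'.X₂.cauchy h₃ T.X₃.pres ?_
    rw [reassoc_of% e₂, reassoc_of% T'.comm₂, e₃, T.comm₂]
  · refine (d₃.mono (Nat.le_succ r)).hom_injective T'.X₃.cauchy h₄ (T.X₁.pres.shift m.data) ?_
    rw [reassoc_of% e₃, reassoc_of% T'.comm₃, ← Functor.map_comp, e₁, T.comm₃]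

lemma nonempty_triangleTower (hm : m.IsExcellent)
    (hT : m.data.IsCauchyTriangles m.M f' g' h')
    (hc : m.data.IsColimitTriangle f' g' h' α β γ f g h) :
    Nonempty (m.TriangleTower α β γ f g h) := by
  obtain ⟨T₀, hT₀⟩ := exists_triangleApprox hm hT hc 0
  choose next hnext t₁ t₂ t₃ e₁ e₂ e₃ c₁ c₂ c₃ using
    fun (T : m.TriangleApprox f g h) (k : ℕ) => T.exists_next hm hT hc k
  let T (n : ℕ) : m.TriangleApprox f g h := Nat.rec T₀ (fun n T => next T (n + 1)) n
  refine ⟨⟨T, fun n => ?_, fun n => t₁ (T n) (n + 1), fun n => t₂ (T n) (n + 1),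
    fun n => t₃ (T n) (n + 1), fun n => e₁ (T n) (n + 1), fun n => e₂ (T n) (n + 1),
    fun n => e₃ (T n) (n + 1), fun n => c₁ (T n) (n + 1), fun n => c₂ (T n) (n + 1),
    fun n => c₃ (T n) (n + 1)⟩⟩
  cases n with
  | zero => exact hT₀
  | succ n => exact hnext (T n) (n + 1)

/-! ### The limit and the colimit of a tower of triangles -/

namespace TriangleTower

variable (T : m.TriangleTower α β γ f g h)

/-- The maps `f` of the inverse sequence of triangles. -/
noncomputable def natF : T.tower₁.invSeq ⟶ T.tower₂.invSeq :=
  NatTrans.ofOpSequence (fun n => ObjectProperty.homMk (T.T n).F) fun n => by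
    rw [Functor.ofOpSequence_map_homOfLE_succ, Functor.ofOpSequence_map_homOfLE_succ]
    exact ObjectProperty.hom_ext _ (T.comm₁ n)

/-- The maps `g` of the inverse sequence of triangles. -/
noncomputable def natG : T.tower₂.invSeq ⟶ T.tower₃.invSeq :=
  NatTrans.ofOpSequence (fun n => ObjectProperty.homMk (T.T n).G) fun n => by
    rw [Functor.ofOpSequence_map_homOfLE_succ, Functor.ofOpSequence_map_homOfLE_succ]
    exact ObjectProperty.hom_ext _ (T.comm₂ n)

/-- The maps `h` of the inverse sequence of triangles. -/
noncomputable def natH : T.tower₃.invSeq ⟶ T.tower₁.invSeq ⋙ m.fsData.shift.functor :=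
  NatTrans.ofOpSequence (fun n => ObjectProperty.homMk (T.T n).H) fun n => by
    rw [Functor.comp_map, Functor.ofOpSequence_map_homOfLE_succ,
      Functor.ofOpSequence_map_homOfLE_succ]
    exact ObjectProperty.hom_ext _ (T.comm₃ n)

end TriangleTower

/-- The limit of a tower of triangles is the approximated triangle. -/
lemma exists_inverseCauchyTriangles (hm : m.IsExcellent)
    (hT : m.data.IsCauchyTriangles m.M f' g' h')
    (hc : m.data.IsColimitTriangle f' g' h' α β γ f g h) (l : ℕ) :
    ∃ (a' b' c' : ℕᵒᵖ ⥤ m.FS) (f'' : a' ⟶ b') (g'' : b' ⟶ c')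
      (h'' : c' ⟶ a' ⋙ m.fsData.shift.functor)
      (α' : m.LimPres a' A) (β' : m.LimPres b' B) (γ' : m.LimPres c' Z),
      m.IsInverseCauchyTriangles f'' g'' h'' ∧
      m.IsLimitTriangle f'' g'' h'' α' β' γ' f g h ∧
      (m.fs B → ∃ N : ℕ, ∀ n, N ≤ n →
        ∃ e : (b'.obj (op n)).obj = B, β'.proj n = eqToHom e.symm) ∧
      ((∃ N : ℕ, ∀ n, N ≤ n → m.M l (c.obj n)) →
        ∃ N : ℕ, ∀ n, N ≤ n → m.fsBall l (c'.obj (op n))) := by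
  obtain ⟨T⟩ := nonempty_triangleTower hm hT hc
  refine ⟨_, _, _, T.natF, T.natG, T.natH, T.tower₁.limPres hm.left_orth,
    T.tower₂.limPres hm.left_orth, T.tower₃.limPres hm.left_orth,
    ⟨T.tower₁.isInverseCauchy, T.tower₂.isInverseCauchy, T.tower₃.isInverseCauchy,
      fun n => (T.T n.unop).strong⟩,
    ⟨fun n => (T.T n).comm₁, fun n => (T.T n).comm₂, fun n => (T.T n).comm₃⟩,
    fun hB => ⟨0, fun n _ => (T.T n).const hB⟩, fun hl => ⟨l, fun n hn => ?_⟩⟩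
  exact ((T.type n).type₃.mono hn).flBall (T.T n).X₃.cauchy hl

/-- `Ŷ` sends the approximated triangle to the colimit of the tower, read in `𝔖(S)^op` as a sequence
of triangles `Σã_* ⟶ c̃_* ⟶ b̃_* ⟶ Σ⁻¹Σã_*`. -/
lemma yhat_isStrongTriangle (hm : m.IsExcellent)
    (hT : m.data.IsCauchyTriangles m.M f' g' h')
    (hc : m.data.IsColimitTriangle f' g' h' α β γ f g h) :
    m.fsData.op.IsStrongTriangle m.fsOpBall
      (m.yhat.map h.op) (m.yhat.map g.op) (m.yhat.map f.op ≫ (m.yhatShift A).hom) := by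
  obtain ⟨T⟩ := nonempty_triangleTower hm hT hc
  let T₁ := T.tower₁.suspend hT.cauchy₁
  have e₁ (n : ℕ) : T₁.invSeq.map (homOfLE (Nat.le_add_right n 1)).op = m.fsData.shift.functor.map
      (T.tower₁.invSeq.map (homOfLE (Nat.le_add_right n 1)).op) := by
    rw [Functor.ofOpSequence_map_homOfLE_succ, Functor.ofOpSequence_map_homOfLE_succ]
    rfl
  let h₁ : T₁.invSeq.rightOp ⟶ T.tower₃.invSeq.rightOp :=
    NatTrans.ofSequence (fun n => (T.natH.app (op n)).op) fun n => Quiver.Hom.unop_inj <|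
      (congrArg (T.natH.app (op (n + 1)) ≫ ·) (e₁ n)).trans
        (T.natH.naturality (homOfLE (Nat.le_add_right n 1)).op).symm
  let f₁ : T.tower₂.invSeq.rightOp ⟶ T₁.invSeq.rightOp ⋙ m.fsData.op.shift.functor :=
    NatTrans.ofSequence
      (fun n => (m.fsData.shift.unitIso.inv.app (T.tower₁.invSeq.obj (op n)) ≫
        T.natF.app (op n)).op) fun n => Quiver.Hom.unop_inj (by
      have e := T.natF.naturality (homOfLE (Nat.le_add_right n 1)).op
      have e' := m.fsData.shift.unitIso.inv.naturality
        (T.tower₁.invSeq.map (homOfLE (Nat.le_add_right n 1)).op)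
      change (_ ≫ _) ≫ _ = m.fsData.shift.inverse.map (T₁.invSeq.map _) ≫ _ ≫ _
      rw [e₁]
      refine (Category.assoc _ _ _).trans ((congrArg (_ ≫ ·) e.symm).trans ?_)
      exact (Category.assoc _ _ _).symm.trans
        ((congrArg (· ≫ _) e'.symm).trans (Category.assoc _ _ _)))
  refine ⟨_, _, _, h₁, NatTrans.rightOp T.natG, f₁, T₁.yhatPres (isCauchy_suspend hT.cauchy₁),
    T.tower₃.yhatPres hT.cauchy₃, T.tower₂.yhatPres hT.cauchy₂,
    ⟨T₁.isInverseCauchy, T.tower₃.isInverseCauchy, T.tower₂.isInverseCauchy, fun n => ?_⟩,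
    ⟨fun n => ?_, fun n => ?_, fun n => ?_⟩⟩
  · have hs := isStrongTriangle_of_iso (T.T n).strong (m.data.modShift.unitIso.app _)
    rw [Iso.app_hom, Iso.app_inv, show m.data.modShift.functor.map
      (m.data.modShift.unitIso.hom.app (T.T n).X₁.obj) = _ from
        (m.data.modShift.counitInv_app_functor _).symm] at hs
    exact hs
  · refine (yhatLeg_map _ _).trans (Eq.trans ?_ (map_yhatLeg _ _).symm)
    exact congrArg yhatLeg (T.T n).comm₃.symm
  · refine (yhatLeg_map _ _).trans (Eq.trans ?_ (map_yhatLeg _ _).symm)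
    exact congrArg yhatLeg (T.T n).comm₂.symm
  · ext W (s : W.unop ⟶ op (T.tower₂.invSeq.obj (op n)))
    -- the suspension of `𝔖(S)^op` being `Σ⁻¹`, the comparison of `Y` with the suspensions applies
    -- `Σ` to a map out of `Σ⁻¹ΣX₁` and precomposes it with `ΣX₁ ≅ ΣΣ⁻¹ΣX₁`
    change m.data.modShift.functor.map (f ≫ (T.T n).X₂.map ≫ s.unop.hom) =
      m.data.modShift.functor.map (T.T n).X₁.map ≫
        (m.data.modShift.counitInv.app (m.data.modShift.functor.obj (T.T n).X₁.obj) ≫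
          m.data.modShift.functor.map (m.data.modShift.unitInv.app (T.T n).X₁.obj ≫
            (T.T n).F ≫ s.unop.hom))
    rw [m.data.modShift.counitInv_app_functor, ← Functor.map_comp, ← Functor.map_comp,
      m.data.modShift.unitIso.hom_inv_id_app_assoc]
    exact congrArg m.data.modShift.functor.map ((Category.assoc _ _ _).symm.trans
      ((congrArg (· ≫ s.unop.hom) (T.T n).comm₁.symm).trans (Category.assoc _ _ _)))

end

end GoodMetric
end ExcellentMetric

/-- For an excellent metric, `Ŷ` sends strong triangles in `𝔏(S)` to strong triangles in
`𝔏(𝔖(S)^op)`, with the arrows reversed. Moreover, for every presentation of a strong triangle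
`A ⟶ B ⟶ C ⟶ ΣA` as the colimit of a Cauchy sequence of distinguished triangles
`a_* ⟶ b_* ⟶ c_* ⟶ Σa_*` in `S`, and every `l`, the triangle is the limit in `Mod-S` of a Cauchy
inverse sequence of distinguished triangles `a'_* ⟶ b'_* ⟶ c'_* ⟶ Σa'_*` in `𝔖(S)` such that:
if `B ∈ 𝔖(S)` then `b'_*` is eventually the constant sequence `B`, with identity maps; and
if `c_n ∈ M_l` for `n ≫ 0` then `c'_n ∈ 𝔑_l` for `n ≫ 0`. -/
theorem proposition3p1 {S : Type u} [Category.{v} S] [Preadditive S] [HasZeroObject S]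
    [HasShift S ℤ] [∀ n : ℤ, (shiftFunctor S n).Additive] [Pretriangulated S] [IsTriangulated S]
    (m : ExcellentMetric.GoodMetric S) (hm : m.IsExcellent)
    {A B C : ExcellentMetric.ModCat S} (f : A ⟶ B) (g : B ⟶ C)
    (h : C ⟶ m.data.modShift.functor.obj A)
    (hfgh : m.data.IsStrongTriangle m.M f g h) :
    m.fsData.op.IsStrongTriangle m.fsOpBall
      (m.yhat.map h.op) (m.yhat.map g.op) (m.yhat.map f.op ≫ (m.yhatShift A).hom) ∧
    ∀ (a b c : ℕ ⥤ S) (f' : a ⟶ b) (g' : b ⟶ c) (h' : c ⟶ a ⋙ m.data.shift.functor)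
      (α : ExcellentMetric.ColimPres a A) (β : ExcellentMetric.ColimPres b B)
      (γ : ExcellentMetric.ColimPres c C),
      m.data.IsCauchyTriangles m.M f' g' h' →
      ExcellentMetric.TriangleData.IsColimitTriangle m.data f' g' h' α β γ f g h →
      ∀ l : ℕ, ∃ (a' b' c' : ℕᵒᵖ ⥤ m.FS) (f'' : a' ⟶ b') (g'' : b' ⟶ c')
        (h'' : c' ⟶ a' ⋙ m.fsData.shift.functor)
        (α' : m.LimPres a' A) (β' : m.LimPres b' B) (γ' : m.LimPres c' C),
        m.IsInverseCauchyTriangles f'' g'' h'' ∧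
        m.IsLimitTriangle f'' g'' h'' α' β' γ' f g h ∧
        (m.fs B → ∃ N : ℕ, ∀ n, N ≤ n →
          ∃ e : (b'.obj (op n)).obj = B, β'.proj n = eqToHom e.symm) ∧
        ((∃ N : ℕ, ∀ n, N ≤ n → m.M l (c.obj n)) →
          ∃ N : ℕ, ∀ n, N ≤ n → m.fsBall l (c'.obj (op n))) := by
  obtain ⟨a, b, c, f', g', h', α, β, γ, hT, hc⟩ := id hfgh
  exact ⟨ExcellentMetric.GoodMetric.yhat_isStrongTriangle hm hT hc,
    fun _ _ _ _ _ _ _ _ _ hT hc l =>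
      ExcellentMetric.GoodMetric.exists_inverseCauchyTriangles hm hT hc l⟩
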